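/- **Setting.** A decision maker has $T\ge 2$ rounds and $B$ divisible unit items $b\in[B]$. In round $t\in[T]$, $N_{t,\theta}$ individuals of type $\theta\in\Theta$ arrive ($\Theta$ finite, nonempty), with utility $w_\theta x$ for an amount $x$, $w_\theta>0$. The $N_{t,\theta}$ are independent, bounded, integer valued random variables with $N_{t,\theta}\ge 1$ a.s. Item $b$ has a random perishing time $T_b\in\{1,2,\dots\}$; the $T_b$ are independent of each other and of the arrivals. What is left of item $b$ after the allocation of round $T_b$ is lost at the end of that round. Items are handed out in the order of a fixed ranking $\sigma:[B]\to[B]$ (a bijection). Put $N_t=\sum_\theta N_{t,\theta}$, $N_{(s,t]}=\sum_{s<r\le t}N_r$, $N_{>t}=N_{(t,T]}$, $N=N_{(0,T]}$, $\beta_{avg}=B/\mathbb E[N]$, $w_{\max}=\max_\theta w_\theta$, $\mu_{\max}=\max_t\mathbb E[N_t]$, and let $\rho_{\max}$ be the maximum over $t,\theta$ of the essential supremum of $|N_{t,\theta}-\mathbb E N_{t,\theta}|$. For an allocation $X_{t,\theta}$ (amount per individual) let $$\Delta_{EF}=\max_{t,\theta}\Big|w_\theta\Big(X_{t,\theta}-\frac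 BN\Big)\Big|,\quad \textsc{Envy}=\max_{t,t',\theta,\theta'}w_\theta(X_{t',\theta'}-X_{t,\theta}),\quad \Delta_{\mathrm{efficiency}}=B-\sum_{t,\theta}N_{t,\theta}X_{t,\theta}.$$ **Algorithm.** Let $\delta\in(0,1)$ and $L_T\ge 0$. Define $$\mathrm{Conf}^N_{s,t}=\sqrt{2(t-s)|\Theta|\rho_{\max}^2\log(2T^2/\delta)},\qquad \mathrm{Conf}^P_t(m)=\tfrac12\Big(\ell_t+\sqrt{\ell_t^2+8m\,\ell_t}\Big),\quad \ell_t=\log\frac{3t\log T}{\delta},$$ $\overline N_{>t}=\mathbb E[N_{>t}]+\mathrm{Conf}^N_{t,T}$, $\overline N=\overline N_{>0}$, and $\underline N_{(s,t]}=\mathbb E[N_{(s,t]}]-\mathrm{Conf}^N_{s,t}$. Let $$\tau_b(t\mid X)=\inf\{t'\in[t,T]:\ \underline N_{(0,t-1]}X+\underline N_{(t-1,t']}X\ge\sigma(b)\}\quad(\inf\emptyset=\infty),$$ $\mu(X)=\sum_b\Pr(T_b<\min\{T,\tau_b(1\mid X)\})$, $\overline\Delta(X)=\min\{B,\mu(X)+\mathrm{Conf}^P_1(\mu(X))\}$,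 $$\underline X=\sup\Big\{X:\ X\le\frac{B-\overline\Delta(X)}{\overline N}\Big\},\qquad \overline X=\underline X+L_T,\qquad \mathcal L^{perish}=\frac B{\overline N}-\underline X,$$ $$\eta_t=\sum_{b:\ \sigma(b)\ge\lceil\underline N_{(0,t-1]}\underline X\rceil}\Pr\big(t\le T_b<\min\{T,\tau_b(t\mid\underline X)\}\big),\qquad \overline P_0=B,\quad \overline P_t=\min\{\overline P_{t-1},\,\eta_t+\mathrm{Conf}^P_t(\eta_t)\}.$$ In round $t$, with remaining budget $B_t$ (the total quantity neither allocated nor perished before round $t$), Perishing-Guardrail gives every individual of the round the amount $B_t/N_t$ if $B_t<N_t\underline X$; otherwise $\overline X$ if $B_t-N_t\overline X\ge\underline X\,\overline N_{>t}+\overline P_t$; otherwise $\underline X$. **Theorem.** There are universal constants $K>0$ and $k\in\mathbb N$ such that for every instance as above, every $\delta\in(0,1)$ and every $L_T\ge0$, with $$\kappa=K\Big[(1+\beta_{avg})(1+|\Theta|)(1+w_{\max})(1+\mu_{\max})(1+\rho_{\max})(1+\log T)\big(1+\log\tfrac1\delta\big)\Big]^k,$$ the allocation of Perishing-Guardrail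 satisfies, with probability at least $1-2\delta$, simultaneously $$\textsc{Envy}\le\kappa L_T,\qquad \Delta_{EF}\le\kappa\max\Big\{L_T,\ \mathcal L^{perish}+\frac1{\sqrt T}\Big\},$$ $$\Delta_{\mathrm{efficiency}}\le\kappa(1+L_T)^k\left(\min\Big\{\sqrt T,\ L_T^{-1}+\sqrt{T L_T^{-1}\mathcal L^{perish}}\Big\}+T\mathcal L^{perish}\right),$$ where for $L_T=0$ the minimum is read as $\sqrt T$. (The factor $(1+L_T)^k$ is bounded in the regime of interest $L_T=o(1)$.) -/

import Mathlib

open MeasureTheory ProbabilityTheory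

noncomputable section

namespace PerishingGuardrail

/-- The data of a problem: a horizon of rounds `1, …, T`, a budget of `B` unit items (the elements
of `Fin B`), the utility weights `w θ`, the numbers `arr t θ` of type-`θ` arrivals in round `t`
(only rounds `1 ≤ t ≤ T` matter), the perishing times of the items, and the allocation schedule
(a ranking of the items, see `Model.rank`). -/
structure Model (Θ Ω : Type*) where
  T : ℕ
  B : ℕ
  w : Θ → ℝ
  arr : ℕ → Θ → Ω → ℕ
  perish : Fin B → Ω → ℕ
  schedule : Equiv.Perm (Fin B)

namespace Model

section

variable {Θ Ω : Type*} [Fintype Θ] [MeasurableSpace Ω]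

/-- The standing assumptions on the primitives, under the probability measure `P`. -/
structure Admissible (M : Model Θ Ω) (P : Measure Ω) : Prop where
  w_pos : ∀ θ, 0 < M.w θ
  measurable_arr : ∀ t ∈ Finset.Icc 1 M.T, ∀ θ, Measurable (M.arr t θ)
  one_le_arr : ∀ t ∈ Finset.Icc 1 M.T, ∀ θ, ∀ᵐ ω ∂P, 1 ≤ M.arr t θ ω
  bounded_arr : ∀ t ∈ Finset.Icc 1 M.T, ∀ θ, MemLp (fun ω => (M.arr t θ ω : ℝ)) ⊤ P
  measurable_perish : ∀ b, Measurable (M.perish b)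
  one_le_perish : ∀ b, ∀ᵐ ω ∂P, 1 ≤ M.perish b ω
  indep_arr : iIndepFun (fun (p : Finset.Icc 1 M.T × Θ) ω => M.arr p.1 p.2 ω) P
  indep_perish : iIndepFun M.perish P
  indep_arr_perish : IndepFun (fun ω (p : Finset.Icc 1 M.T × Θ) => M.arr p.1 p.2 ω)
    (fun ω b => M.perish b ω) P

/-- The rank in `{1, …, B}` of an item in the allocation schedule. -/
def rank (M : Model Θ Ω) (b : Fin M.B) : ℕ := (M.schedule b : ℕ) + 1

/-- `N_t`, the number of arrivals in round `t`. -/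
def arrivals (M : Model Θ Ω) (t : ℕ) (ω : Ω) : ℝ := ∑ θ, (M.arr t θ ω : ℝ)

/-- `N_{(s,t]}`, the number of arrivals in the rounds `s + 1, …, t`. -/
def arrivalsIoc (M : Model Θ Ω) (s t : ℕ) (ω : Ω) : ℝ := ∑ r ∈ Finset.Ioc s t, M.arrivals r ω

/-- `N`, the total number of arrivals. -/
def totalArrivals (M : Model Θ Ω) (ω : Ω) : ℝ := M.arrivalsIoc 0 M.T ω

/-- `E[N_{(s,t]}]`. -/
def meanArrivals (M : Model Θ Ω) (P : Measure Ω) (s t : ℕ) : ℝ := ∫ ω, M.arrivalsIoc s t ω ∂P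

/-- `β_avg = B / E[N]`. -/
def betaAvg (M : Model Θ Ω) (P : Measure Ω) : ℝ := M.B / M.meanArrivals P 0 M.T

/-- `w_max`. -/
def wMax (M : Model Θ Ω) : ℝ := ⨆ θ, M.w θ

/-- `μ_max`, the maximal expected number of arrivals in a round. -/
def muMax (M : Model Θ Ω) (P : Measure Ω) : ℝ :=
  ⨆ t : Finset.Icc 1 M.T, ∫ ω, M.arrivals t ω ∂P

/-- `ρ_{t,θ}`, the almost sure (essential) supremum of `|N_{t,θ} - E[N_{t,θ}]|`. -/
def rho (M : Model Θ Ω) (P : Measure Ω) (t : ℕ) (θ : Θ) : ℝ :=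
  (eLpNormEssSup (fun ω => (M.arr t θ ω : ℝ) - ∫ ω', (M.arr t θ ω' : ℝ) ∂P) P).toReal

/-- `ρ_max`. -/
def rhoMax (M : Model Θ Ω) (P : Measure Ω) : ℝ :=
  ⨆ p : Finset.Icc 1 M.T × Θ, M.rho P p.1 p.2

/-! ### Metrics of an allocation `X t θ ω` (amount per type-`θ` individual in round `t`) -/

/-- Counterfactual envy. -/
def counterfactualEnvy (M : Model Θ Ω) (X : ℕ → Θ → Ω → ℝ) (ω : Ω) : ℝ :=
  ⨆ p : Finset.Icc 1 M.T × Θ, |M.w p.2 * (X p.1 p.2 ω - M.B / M.totalArrivals ω)|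

/-- Hindsight envy. -/
def hindsightEnvy (M : Model Θ Ω) (X : ℕ → Θ → Ω → ℝ) (ω : Ω) : ℝ :=
  ⨆ p : (Finset.Icc 1 M.T × Θ) × (Finset.Icc 1 M.T × Θ),
    M.w p.1.2 * (X p.2.1 p.2.2 ω - X p.1.1 p.1.2 ω)

/-- Inefficiency. -/
def inefficiency (M : Model Θ Ω) (X : ℕ → Θ → Ω → ℝ) (ω : Ω) : ℝ :=
  M.B - ∑ t ∈ Finset.Icc 1 M.T, ∑ θ, (M.arr t θ ω : ℝ) * X t θ ω

/-! ### Confidence terms and pessimistic forecasts -/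

/-- `Conf^N_{s,t}`, the confidence term for `N_{(s,t]}`. -/
def confN (M : Model Θ Ω) (P : Measure Ω) (δ : ℝ) (s t : ℕ) : ℝ :=
  Real.sqrt (2 * ((t : ℝ) - s) * Fintype.card Θ * M.rhoMax P ^ 2
    * Real.log (2 * (M.T : ℝ) ^ 2 / δ))

/-- `Conf^P_t(m)`. -/
def confP (M : Model Θ Ω) (δ : ℝ) (t : ℕ) (m : ℝ) : ℝ :=
  1 / 2 * (Real.log (3 * t * Real.log M.T / δ) +
    Real.sqrt (Real.log (3 * t * Real.log M.T / δ) ^ 2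
      + 8 * m * Real.log (3 * t * Real.log M.T / δ)))

/-- The upper bound for `N_{>t}`; for `t = 0` it is the upper bound for `N`. -/
def upperN (M : Model Θ Ω) (P : Measure Ω) (δ : ℝ) (t : ℕ) : ℝ :=
  M.meanArrivals P t M.T + M.confN P δ t M.T

/-- The lower bound for `N_{(s,t]}`. -/
def lowerN (M : Model Θ Ω) (P : Measure Ω) (δ : ℝ) (s t : ℕ) : ℝ :=
  M.meanArrivals P s t - M.confN P δ s t

/-- `τ_b(t | X, σ)`: the first round `t' ≥ t` in which the slow consumption process has reached
item `b` (`⊤` if there is none in the horizon). Here `N_{<t} = N_{(0,t-1]}` and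
`N_{[t,t']} = N_{(t-1,t']}`. -/
def slowTime (M : Model Θ Ω) (P : Measure Ω) (δ : ℝ) (t : ℕ) (X : ℝ) (b : Fin M.B) : ℕ∞ :=
  sInf {u : ℕ∞ | ∃ t' : ℕ, u = t' ∧ t ≤ t' ∧ t' ≤ M.T ∧
    (M.rank b : ℝ) ≤ M.lowerN P δ 0 (t - 1) * X + M.lowerN P δ (t - 1) t' * X}

/-- The items left at the beginning of round `t` by the slow consumption process. -/
def slowItems (M : Model Θ Ω) (P : Measure Ω) (δ : ℝ) (t : ℕ) (X : ℝ) : Finset (Fin M.B) :=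
  Finset.univ.filter fun b => ⌈M.lowerN P δ 0 (t - 1) * X⌉ ≤ (M.rank b : ℤ)

/-- `μ(X)`. -/
def mu (M : Model Θ Ω) (P : Measure Ω) (δ : ℝ) (X : ℝ) : ℝ :=
  ∑ b, P.real {ω | (M.perish b ω : ℕ∞) < min (M.T : ℕ∞) (M.slowTime P δ 1 X b)}

/-- The worst-case perishing loss of the static allocation `X`. -/
def worstLoss (M : Model Θ Ω) (P : Measure Ω) (δ : ℝ) (X : ℝ) : ℝ :=
  min (M.B : ℝ) (M.mu P δ X + M.confP δ 1 (M.mu P δ X))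

/-- The lower guardrail. -/
def xLow (M : Model Θ Ω) (P : Measure Ω) (δ : ℝ) : ℝ :=
  sSup {X : ℝ | X ≤ (M.B - M.worstLoss P δ X) / M.upperN P δ 0}

/-- The upper guardrail, for the envy parameter `L`. -/
def xUp (M : Model Θ Ω) (P : Measure Ω) (δ L : ℝ) : ℝ := M.xLow P δ + L

/-- The perishing-induced loss. -/
def perishLoss (M : Model Θ Ω) (P : Measure Ω) (δ : ℝ) : ℝ :=
  M.B / M.upperN P δ 0 - M.xLow P δ

/-- `η_t`. -/
def eta (M : Model Θ Ω) (P : Measure Ω) (δ : ℝ) (t : ℕ) : ℝ :=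
  ∑ b ∈ M.slowItems P δ t (M.xLow P δ),
    P.real {ω | t ≤ M.perish b ω ∧
      (M.perish b ω : ℕ∞) < min (M.T : ℕ∞) (M.slowTime P δ t (M.xLow P δ) b)}

/-- The pessimistic forecast of the perishing from round `t` on. -/
def perishForecast (M : Model Θ Ω) (P : Measure Ω) (δ : ℝ) : ℕ → ℝ
  | 0 => M.B
  | t + 1 => min (perishForecast M P δ t)
      (M.eta P δ (t + 1) + M.confP δ (t + 1) (M.eta P δ (t + 1)))

/-! ### The algorithm -/

/-- The per-individual amount that the algorithm allocates in round `t` when the budget remaining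
at the beginning of that round is `Bt`. -/
def decision (M : Model Θ Ω) (P : Measure Ω) (δ L : ℝ) (t : ℕ) (Bt : ℝ) (ω : Ω) : ℝ :=
  if Bt < M.arrivals t ω * M.xLow P δ then Bt / M.arrivals t ω
  else if M.xLow P δ * M.upperN P δ t + M.perishForecast P δ t
      ≤ Bt - M.arrivals t ω * M.xUp P δ L then M.xUp P δ L
  else M.xLow P δ

/-- The quantity of item `b` that is handed out when a total amount `a` is allocated in the order
of the schedule and `r b'` is what remains of item `b'`. -/
def handedOut (M : Model Θ Ω) (r : Fin M.B → ℝ) (a : ℝ) (b : Fin M.B) : ℝ :=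
  min (r b) (max 0 (a - ∑ b' ∈ Finset.univ.filter (fun b' => M.rank b' < M.rank b), r b'))

/-- `stock t ω b` is what remains of item `b` at the end of round `t` (i.e. at the beginning of
round `t + 1`): first the arrivals of the round are served, then everything that is left of the
items with perishing time `t` is lost. -/
def stock (M : Model Θ Ω) (P : Measure Ω) (δ L : ℝ) : ℕ → Ω → Fin M.B → ℝ
  | 0 => fun _ _ => 1
  | t + 1 => fun ω b =>
      if M.perish b ω = t + 1 then 0
      else stock M P δ L t ω b - M.handedOut (stock M P δ L t ω)
        (M.arrivals (t + 1) ω *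
          M.decision P δ L (t + 1) (∑ b', stock M P δ L t ω b') ω) b

/-- The budget of the algorithm at the beginning of round `t ≥ 1`. -/
def budget (M : Model Θ Ω) (P : Measure Ω) (δ L : ℝ) (t : ℕ) (ω : Ω) : ℝ :=
  ∑ b, M.stock P δ L (t - 1) ω b

/-- The allocation of the algorithm Perishing-Guardrail (the same for all types). -/
def guardrail (M : Model Θ Ω) (P : Measure Ω) (δ L : ℝ) (t : ℕ) (_θ : Θ) (ω : Ω) : ℝ :=
  M.decision P δ L t (M.budget P δ L t ω) ω

/-! ### Rates -/

/-- The factor that `≲` hides: `K` times the `k`-th power of `1 + x` for each of the parameters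
`x = β_avg, |Θ|, w_max, μ_max, ρ_max, log T, log (1/δ)`. -/
def hiddenFactor (M : Model Θ Ω) (P : Measure Ω) (δ K : ℝ) (k : ℕ) : ℝ :=
  K * ((1 + M.betaAvg P) * (1 + Fintype.card Θ) * (1 + M.wMax) * (1 + M.muMax P)
    * (1 + M.rhoMax P) * (1 + Real.log M.T) * (1 + Real.log (1 / δ))) ^ k

end

end Model

/-- `min {√T, L⁻¹ + √(T L⁻¹ ℓ)}`, where `L⁻¹ = ∞` for `L = 0`. -/
def efficiencyRate (T : ℕ) (L l : ℝ) : ℝ :=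
  if L = 0 then Real.sqrt T
  else min (Real.sqrt T) (L⁻¹ + Real.sqrt (T * L⁻¹ * l))

end PerishingGuardrail

end

/-! All randomness is confined to the event `Good`, on which every confidence bound holds; the rest
is pathwise. Arrivals in all windows concentrate by Hoeffding's inequality. The actual losses depend
on the adaptive allocation, but the slow consumption process, which grants `xLow` to pessimistically
few arrivals, has deterministic thresholds. The number of items it loses is therefore a sum of
independent indicators, and a Chernoff bound applies (`Admissible.measureReal_not_good_le`).

On a good outcome, as long as everyone gets at least `xLow`, consumption is no slower than in the
slow process, so an item lost before the horizon is lost by the slow process too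
(`Good.mem_slowLost`). Since `xLow` solves `xLow * upperN 0 + worstLoss xLow = B`
(`xLow_mul_upperN`) and the upper guardrail is granted only when the forecasts stay affordable, the
budget never runs out (`Good.served`). All allocations then lie in `[xLow, xLow + L]`. This bounds
the envy; moreover `B / N - xLow` is `perishLoss` plus an error of order `1 / √T`.

For the efficiency, `upperN 0 * perishLoss = worstLoss xLow` turns perishing into `T * perishLoss`.
Granting `xLow` alone leaves a further `√T` (`Good.inefficiency_le_sqrt`). For `L > 0`, let `s` be
the last round with the lower guardrail: the slack of the arrival forecast is of order `√(T - s)`,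
while the later rounds hand out at least `L (T - s)` extra, and the difference is of order `L⁻¹`
(`Good.inefficiency_le_inv`). -/

namespace PerishingGuardrail

/-! ### Tail bounds: Hoeffding for arrivals, Chernoff for perishing -/

section Concentration

variable {Ω : Type*} [MeasurableSpace Ω]

/-- The two-sided tail bound for a sub-Gaussian random variable. -/
lemma measureReal_sqrt_lt_abs_le {μ : Measure Ω} [IsProbabilityMeasure μ] {S : Ω → ℝ}
    {c : NNReal} (hS : HasSubgaussianMGF S c μ) {l : ℝ} (hl : 0 ≤ l) :
    μ.real {ω | Real.sqrt (2 * c * l) < |S ω|} ≤ 2 * Real.exp (-l) := by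
  -- For `c = 0` the Chernoff exponent would divide by zero; there `S = 0` almost surely, and the
  -- strict inequality excludes this value.
  rcases eq_or_ne c 0 with rfl | hc
  · have h0 := hS.ae_eq_zero_of_hasSubgaussianMGF_zero
    have : μ.real {ω | Real.sqrt (2 * (0 : NNReal) * l) < |S ω|} = 0 := by
      rw [measureReal_eq_zero_iff]
      refine measure_eq_zero_iff_ae_notMem.2 ?_
      filter_upwards [h0] with ω hω
      simp [hω]
    rw [this]
    positivity
  · have hc' : (0 : ℝ) < c := by positivity
    have hexp : -Real.sqrt (2 * c * l) ^ 2 / (2 * c) = -l := by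
      rw [Real.sq_sqrt (by positivity)]
      field_simp
    have h1 := hS.measure_ge_le (Real.sqrt_nonneg (2 * c * l))
    have h2 := hS.neg.measure_ge_le (Real.sqrt_nonneg (2 * c * l))
    rw [hexp] at h1 h2
    calc μ.real {ω | Real.sqrt (2 * c * l) < |S ω|}
        ≤ μ.real ({ω | Real.sqrt (2 * c * l) ≤ S ω} ∪ {ω | Real.sqrt (2 * c * l) ≤ (-S) ω}) := by
          refine measureReal_mono fun ω hω => ?_
          rcases lt_abs.1 (Set.mem_ofPred.1 hω) with h | h
          · exact Or.inl h.le
          · exact Or.inr h.le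
      _ ≤ _ := (measureReal_union_le _ _).trans (by linarith)

/-- **Hoeffding's inequality** for independent random variables whose deviation from the mean is
at most `ρ`. -/
lemma measureReal_abs_sum_sub_integral_le {ι : Type*} {μ : Measure Ω} [IsProbabilityMeasure μ]
    {X : ι → Ω → ℝ} (hX : ∀ i, Measurable (X i)) (hind : iIndepFun X μ) {ρ : ℝ} (hρ : 0 ≤ ρ)
    (hb : ∀ i, ∀ᵐ ω ∂μ, |X i ω - ∫ ω', X i ω' ∂μ| ≤ ρ) (s : Finset ι) {l : ℝ} (hl : 0 ≤ l) :
    μ.real {ω | Real.sqrt (2 * (s.card * ρ ^ 2) * l) < |∑ i ∈ s, (X i ω - ∫ ω', X i ω' ∂μ)|}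
      ≤ 2 * Real.exp (-l) := by
  lift ρ to NNReal using hρ
  have hsub : ∀ i ∈ s, HasSubgaussianMGF (fun ω => X i ω - ∫ ω', X i ω' ∂μ)
      (ρ ^ 2) μ := fun i _ => by
    -- Hoeffding's lemma on an interval of length `2ρ` gives the variance proxy `ρ ^ 2`.
    have := hasSubgaussianMGF_of_mem_Icc (μ := μ) (X := X i)
      (a := (∫ ω', X i ω' ∂μ) - ρ) (b := (∫ ω', X i ω' ∂μ) + ρ) (hX i).aemeasurable
      (by
        filter_upwards [hb i] with ω hω
        rw [abs_le] at hω
        constructor <;> linarith)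
    convert this using 2
    ext
    simp only [NNReal.coe_div, coe_nnnorm, NNReal.coe_ofNat]
    rw [show (∫ ω', X i ω' ∂μ) + ρ - ((∫ ω', X i ω' ∂μ) - ρ) = 2 * ρ by ring,
      Real.norm_of_nonneg (by positivity)]
    ring
  have hind' : iIndepFun (fun i ω => X i ω - ∫ ω', X i ω' ∂μ) μ :=
    hind.comp (fun i x => x - ∫ ω', X i ω' ∂μ) fun i => measurable_id.sub_const _
  have h := measureReal_sqrt_lt_abs_le (HasSubgaussianMGF.sum_of_iIndepFun hind' hsub) hl
  simpa using h

/-- A Chernoff bound for the number of events that occur among independent ones. -/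
lemma measureReal_sum_indicator_ge_le {ι : Type*} {μ : Measure Ω} [IsProbabilityMeasure μ]
    {A : ι → Set Ω} (hA : ∀ i, MeasurableSet (A i))
    (hind : iIndepFun (fun i => (A i).indicator (fun _ => (1 : ℝ))) μ) (s : Finset ι)
    {c : ℝ} (hc : 0 < c) :
    μ.real {ω | ∑ i ∈ s, μ.real (A i) + c ≤ ∑ i ∈ s, (A i).indicator (fun _ => (1 : ℝ)) ω}
      ≤ Real.exp (-(c ^ 2 / (2 * ∑ i ∈ s, μ.real (A i) + c))) := by
  set m := ∑ i ∈ s, μ.real (A i) with hm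
  have hm0 : 0 ≤ m := Finset.sum_nonneg fun i _ => measureReal_nonneg
  have hmeas : ∀ i, Measurable ((A i).indicator (fun _ => (1 : ℝ))) := fun i =>
    measurable_const.indicator (hA i)
  have hmgf : ∀ i (t : ℝ), mgf ((A i).indicator (fun _ => (1 : ℝ))) μ t
      = 1 + μ.real (A i) * (Real.exp t - 1) := fun i t => by
    have : (fun ω => Real.exp (t * (A i).indicator (fun _ => (1 : ℝ)) ω))
        = fun ω => 1 + (A i).indicator (fun _ => Real.exp t - 1) ω := by
      funext ω
      by_cases h : ω ∈ A i <;> simp [h]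
    rw [mgf, this, integral_add (integrable_const _)
      ((integrable_const _).indicator (hA i)), integral_indicator_const _ (hA i)]
    simp
  have key : ∀ t : ℝ, 0 ≤ t →
      μ.real {ω | m + c ≤ ∑ i ∈ s, (A i).indicator (fun _ => (1 : ℝ)) ω}
        ≤ Real.exp (m * (Real.exp t - 1) - t * (m + c)) := fun t ht => by
    have hint : Integrable (fun ω => Real.exp (t * (∑ i ∈ s, (A i).indicator
        (fun _ => (1 : ℝ))) ω)) μ := by
      refine Integrable.of_bound (C := Real.exp (t * s.card)) ?_ (Filter.Eventually.of_forall ?_)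
      · simp only [Finset.sum_apply]
        exact ((Finset.measurable_sum s fun i _ => hmeas i).const_mul t).exp.aestronglyMeasurable
      · intro ω
        rw [Real.norm_of_nonneg (Real.exp_pos _).le]
        gcongr
        rw [Finset.sum_apply]
        refine (Finset.sum_le_card_nsmul s _ 1 fun i _ => ?_).trans_eq (by simp)
        exact Set.indicator_le_self' (fun _ _ => zero_le_one) ω
    have h := measure_ge_le_exp_mul_mgf (μ := μ) (m + c) ht hint
    simp only [Finset.sum_apply] at h
    refine h.trans ?_
    rw [hind.mgf_sum hmeas]
    -- Comparison with a Poisson variable of mean `m`, by `1 + x ≤ exp x` in each factor.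
    calc Real.exp (-t * (m + c)) * ∏ i ∈ s, mgf ((A i).indicator (fun _ => (1 : ℝ))) μ t
        ≤ Real.exp (-t * (m + c)) * ∏ i ∈ s, Real.exp (μ.real (A i) * (Real.exp t - 1)) := by
          gcongr with i
          · exact fun i _ => mgf_nonneg
          · rw [hmgf, add_comm]
            exact Real.add_one_le_exp _
      _ = Real.exp (m * (Real.exp t - 1) - t * (m + c)) := by
          rw [← Real.exp_sum, ← Real.exp_add, ← Finset.sum_mul, ← hm]
          ring_nf
  -- The optimal `t` is `log (1 + c / m)`. For `m = 0` it does not exist, and `t = 1` already gives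
  -- `exp (-c)`. For `m > 0`, the inequality `2x / (x + 2) ≤ log (1 + x)` simplifies the exponent.
  rcases hm0.eq_or_lt with h0 | h0
  · refine (key 1 zero_le_one).trans (Real.exp_le_exp.2 ?_)
    rw [← h0]
    field_simp
    linarith [sq c]
  · refine (key (Real.log (1 + c / m)) (Real.log_nonneg (by
      have : 0 < c / m := by positivity
      linarith))).trans (Real.exp_le_exp.2 ?_)
    rw [Real.exp_log (by positivity)]
    have hlog := Real.le_log_one_add_of_nonneg (x := c / m) (by positivity)
    have h1 : 2 * (c / m) / (c / m + 2) = 2 * c / (2 * m + c) := by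
      field_simp
      ring
    rw [h1] at hlog
    have h2 : (m + c) * (2 * c / (2 * m + c)) ≤ (m + c) * Real.log (1 + c / m) := by gcongr
    have h3 : m * (1 + c / m - 1) = c := by
      field_simp
      ring
    have h4 : c - (m + c) * (2 * c / (2 * m + c)) = -(c ^ 2 / (2 * m + c)) := by
      field_simp
      ring
    rw [h3]
    linarith

end Concentration

namespace Model

section HandedOut

variable {Θ Ω : Type*} (M : Model Θ Ω)

/-! ### The items handed out -/

lemma rank_pos (b : Fin M.B) : 1 ≤ M.rank b := Nat.le_add_left _ _

lemma rank_le (b : Fin M.B) : M.rank b ≤ M.B := (M.schedule b).isLt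

lemma filter_rank_le_succ_of_lt {k : ℕ} (hk : k < M.B) :
    Finset.univ.filter (fun b => M.rank b ≤ k + 1)
      = insert (M.schedule.symm ⟨k, hk⟩) (Finset.univ.filter fun b => M.rank b ≤ k) := by
  ext b
  simp only [Finset.mem_filter, Finset.mem_univ, true_and, Finset.mem_insert]
  simp only [rank, Equiv.eq_symm_apply, Fin.ext_iff]
  omega

/-- Induction along the schedule: the next item supplies the part of `a` that the earlier items
could not cover, up to its own stock. -/
lemma sum_handedOut_rank_le {r : Fin M.B → ℝ} (hr : ∀ b, 0 ≤ r b) {a : ℝ} (ha : 0 ≤ a) (k : ℕ) :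
    ∑ b with M.rank b ≤ k, M.handedOut r a b = min a (∑ b with M.rank b ≤ k, r b) := by
  induction k with
  | zero =>
    have : Finset.univ.filter (fun b => M.rank b ≤ 0) = ∅ := by
      ext b
      have := M.rank_pos b
      simp only [Finset.mem_filter, Finset.mem_univ, true_and, Finset.notMem_empty, iff_false]
      omega
    rw [this, Finset.sum_empty, Finset.sum_empty, min_eq_right ha]
  | succ k ih =>
    by_cases hk : k < M.B
    · set b₀ := M.schedule.symm ⟨k, hk⟩ with hb₀
      have hrank : M.rank b₀ = k + 1 := by simp [rank, hb₀]
      have hnot : b₀ ∉ Finset.univ.filter fun b => M.rank b ≤ k := by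
        simp [hrank]
      rw [M.filter_rank_le_succ_of_lt hk, ← hb₀, Finset.sum_insert hnot, Finset.sum_insert hnot, ih,
        handedOut, hrank]
      simp only [Nat.lt_succ_iff]
      set R := ∑ b with M.rank b ≤ k, r b
      have := hr b₀
      rcases le_total a R with h | h
      · rw [max_eq_left (by linarith), min_eq_left h, min_eq_right this, min_eq_left (by linarith)]
        ring
      · rw [max_eq_right (by linarith), min_eq_right h]
        rcases le_total (r b₀) (a - R) with h' | h'
        · rw [min_eq_left h', min_eq_right (by linarith)]
        · rw [min_eq_right h', min_eq_left (by linarith)]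
          ring
    · have : Finset.univ.filter (fun b => M.rank b ≤ k + 1)
          = Finset.univ.filter fun b => M.rank b ≤ k := by
        ext b
        have := M.rank_le b
        simp only [Finset.mem_filter, Finset.mem_univ, true_and]
        omega
      rw [this, ih]

lemma filter_rank_le_budget : Finset.univ.filter (fun b => M.rank b ≤ M.B) = Finset.univ := by
  ext b
  simp [M.rank_le b]

lemma card_filter_rank_le (k : ℕ) : (Finset.univ.filter fun b => M.rank b ≤ k).card ≤ k := by
  calc (Finset.univ.filter fun b => M.rank b ≤ k).card
      ≤ (Finset.range k).card := by
        refine Finset.card_le_card_of_injOn (fun b => (M.schedule b : ℕ)) ?_ ?_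
        · intro b hb
          have hb' : M.rank b ≤ k := by simpa using hb
          simpa [rank, Nat.succ_le_iff] using hb'
        · intro b _ b' _ h
          exact M.schedule.injective (Fin.ext h)
    _ = k := Finset.card_range k

lemma sum_handedOut {r : Fin M.B → ℝ} (hr : ∀ b, 0 ≤ r b) {a : ℝ} (ha : 0 ≤ a)
    (ha' : a ≤ ∑ b, r b) : ∑ b, M.handedOut r a b = a := by
  have := M.sum_handedOut_rank_le hr ha M.B
  rwa [filter_rank_le_budget, min_eq_left ha'] at this

lemma handedOut_le (r : Fin M.B → ℝ) (a : ℝ) (b : Fin M.B) : M.handedOut r a b ≤ r b :=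
  min_le_left _ _

lemma handedOut_nonneg {r : Fin M.B → ℝ} (hr : ∀ b, 0 ≤ r b) (a : ℝ) (b : Fin M.B) :
    0 ≤ M.handedOut r a b :=
  le_min (hr b) (le_max_left _ _)

lemma filter_rank_le_eq_insert (b : Fin M.B) :
    Finset.univ.filter (fun b' => M.rank b' ≤ M.rank b)
      = insert b (Finset.univ.filter fun b' => M.rank b' < M.rank b) := by
  ext b'
  simp only [Finset.mem_filter, Finset.mem_univ, true_and, Finset.mem_insert]
  rw [rank, rank, ← M.schedule.injective.eq_iff, Fin.ext_iff]
  omega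

/-- If something of an item is left, then the whole amount was taken from that item and the
items ranked before it. -/
lemma lt_sum_rank_le_of_handedOut_lt {r : Fin M.B → ℝ} {a : ℝ} {b : Fin M.B}
    (h : M.handedOut r a b < r b) : a < ∑ b' with M.rank b' ≤ M.rank b, r b' := by
  rw [filter_rank_le_eq_insert, Finset.sum_insert (by simp)]
  rw [handedOut, min_lt_iff] at h
  have := (le_max_right _ _).trans_lt (h.resolve_left (lt_irrefl _))
  linarith

end HandedOut

section Path

variable {Θ Ω : Type*} [Fintype Θ] [MeasurableSpace Ω] (M : Model Θ Ω) (P : Measure Ω) (δ L : ℝ)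

/-! ### Evolution of the stock -/

/-- The total amount that the algorithm allocates in round `t`. -/
noncomputable def amount (t : ℕ) (ω : Ω) : ℝ :=
  M.arrivals t ω * M.decision P δ L t (M.budget P δ L t ω) ω

/-- What remains of an item when the arrivals of round `t` have been served. -/
noncomputable def residual (t : ℕ) (ω : Ω) (b : Fin M.B) : ℝ :=
  M.stock P δ L (t - 1) ω b - M.handedOut (M.stock P δ L (t - 1) ω) (M.amount P δ L t ω) b

/-- The quantity that perishes at the end of round `t`. -/
noncomputable def loss (t : ℕ) (ω : Ω) : ℝ := ∑ b, if M.perish b ω = t then M.residual P δ L t ω b else 0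

lemma stock_succ (t : ℕ) (ω : Ω) (b : Fin M.B) :
    M.stock P δ L (t + 1) ω b
      = if M.perish b ω = t + 1 then 0 else M.residual P δ L (t + 1) ω b := rfl

lemma budget_succ (t : ℕ) (ω : Ω) : M.budget P δ L (t + 1) ω = ∑ b, M.stock P δ L t ω b := rfl

lemma residual_nonneg (t : ℕ) (ω : Ω) (b : Fin M.B) : 0 ≤ M.residual P δ L t ω b :=
  sub_nonneg.2 (M.handedOut_le _ _ _)

lemma stock_nonneg (t : ℕ) (ω : Ω) (b : Fin M.B) : 0 ≤ M.stock P δ L t ω b := by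
  cases t with
  | zero => exact zero_le_one
  | succ t =>
    rw [stock_succ]
    split_ifs
    · exact le_rfl
    · exact M.residual_nonneg P δ L _ ω b

lemma residual_le_stock (t : ℕ) (ω : Ω) (b : Fin M.B) :
    M.residual P δ L t ω b ≤ M.stock P δ L (t - 1) ω b :=
  sub_le_self _ (M.handedOut_nonneg (M.stock_nonneg P δ L _ ω) _ _)

lemma stock_succ_le_residual (t : ℕ) (ω : Ω) (b : Fin M.B) :
    M.stock P δ L (t + 1) ω b ≤ M.residual P δ L (t + 1) ω b := by
  rw [stock_succ]
  split_ifs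
  · exact M.residual_nonneg P δ L _ ω b
  · exact le_rfl

lemma stock_le_one (t : ℕ) (ω : Ω) (b : Fin M.B) : M.stock P δ L t ω b ≤ 1 := by
  induction t with
  | zero => exact le_rfl
  | succ t ih =>
    exact (M.stock_succ_le_residual P δ L t ω b).trans
      ((M.residual_le_stock P δ L (t + 1) ω b).trans ih)

lemma residual_le_one (t : ℕ) (ω : Ω) (b : Fin M.B) : M.residual P δ L t ω b ≤ 1 :=
  (M.residual_le_stock P δ L t ω b).trans (M.stock_le_one P δ L _ ω b)

lemma loss_nonneg (t : ℕ) (ω : Ω) : 0 ≤ M.loss P δ L t ω :=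
  Finset.sum_nonneg fun b _ => by
    split_ifs
    · exact M.residual_nonneg P δ L t ω b
    · exact le_rfl

lemma sum_stock_zero (ω : Ω) : ∑ b, M.stock P δ L 0 ω b = M.B := by
  simp [stock]

variable {M P δ L}

/-- Mass balance of a round. The two hypotheses ensure that exactly the intended amount is handed
out. -/
lemma sum_stock_succ {t : ℕ} {ω : Ω} (h0 : 0 ≤ M.amount P δ L (t + 1) ω)
    (h1 : M.amount P δ L (t + 1) ω ≤ M.budget P δ L (t + 1) ω) :
    ∑ b, M.stock P δ L (t + 1) ω b = ∑ b, M.stock P δ L t ω b - M.amount P δ L (t + 1) ω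
      - M.loss P δ L (t + 1) ω := by
  have h := M.sum_handedOut (M.stock_nonneg P δ L t ω) h0 h1
  have h2 : ∑ b, M.residual P δ L (t + 1) ω b
      = ∑ b, M.stock P δ L t ω b - M.amount P δ L (t + 1) ω := by
    simp only [residual, Finset.sum_sub_distrib, Nat.add_sub_cancel, h]
  rw [← h2, loss, ← Finset.sum_sub_distrib]
  refine Finset.sum_congr rfl fun b _ => ?_
  rw [stock_succ]
  split_ifs <;> simp

/-- The left side is a potential that starts at no more than the rank. While something of `b` is
left, allocations are taken entirely from items ranked up to `b`, so they leave the potential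
unchanged; perishing only lowers it. -/
lemma sum_amount_add_sum_stock_le {t : ℕ} {ω : Ω} {b : Fin M.B}
    (h0 : ∀ r ∈ Finset.Ioc 0 t, 0 ≤ M.amount P δ L r ω) (hb : 0 < M.stock P δ L t ω b) :
    ∑ r ∈ Finset.Ioc 0 t, M.amount P δ L r ω
      + ∑ b' with M.rank b' ≤ M.rank b, M.stock P δ L t ω b' ≤ M.rank b := by
  induction t with
  | zero =>
    simp only [stock, Finset.Ioc_self, Finset.sum_empty, Finset.sum_const, nsmul_eq_mul, mul_one,
      zero_add]
    exact_mod_cast M.card_filter_rank_le _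
  | succ t ih =>
    have hres := hb.trans_le (M.stock_succ_le_residual P δ L t ω b)
    have ih := ih (fun r hr => h0 r (Finset.Ioc_subset_Ioc_right t.le_succ hr))
      (hres.trans_le (M.residual_le_stock P δ L (t + 1) ω b))
    have hlt := M.lt_sum_rank_le_of_handedOut_lt (sub_pos.1 hres)
    have hsum := M.sum_handedOut_rank_le (M.stock_nonneg P δ L t ω)
      (h0 (t + 1) (by simp)) (M.rank b)
    simp only [Nat.add_sub_cancel] at hlt
    rw [min_eq_left hlt.le] at hsum
    have h2 : ∑ b' with M.rank b' ≤ M.rank b, M.stock P δ L (t + 1) ω b'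
        ≤ ∑ b' with M.rank b' ≤ M.rank b, M.stock P δ L t ω b' - M.amount P δ L (t + 1) ω := by
      rw [← hsum, ← Finset.sum_sub_distrib]
      exact Finset.sum_le_sum fun b' _ => M.stock_succ_le_residual P δ L t ω b'
    rw [Finset.sum_Ioc_succ_top (Nat.zero_le t)]
    linarith

/-- As long as something of an item is left, less than its rank has been allocated. -/
lemma sum_amount_lt_rank {t : ℕ} {ω : Ω} {b : Fin M.B} (ht : 1 ≤ t)
    (h0 : ∀ r ∈ Finset.Ioc 0 t, 0 ≤ M.amount P δ L r ω) (hb : 0 < M.residual P δ L t ω b) :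
    ∑ r ∈ Finset.Ioc 0 t, M.amount P δ L r ω < M.rank b := by
  obtain ⟨t, rfl⟩ := Nat.exists_eq_add_of_le' ht
  have h := sum_amount_add_sum_stock_le (P := P) (δ := δ) (L := L)
    (fun r hr => h0 r (Finset.Ioc_subset_Ioc_right t.le_succ hr))
    (hb.trans_le (M.residual_le_stock P δ L (t + 1) ω b))
  have hlt := M.lt_sum_rank_le_of_handedOut_lt (sub_pos.1 hb)
  simp only [Nat.add_sub_cancel] at hlt
  rw [Finset.sum_Ioc_succ_top (Nat.zero_le t)]
  linarith

end Path

section Forecast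

variable {Θ Ω : Type*} (M : Model Θ Ω) (δ : ℝ)

/-! ### The confidence terms and the lower guardrail -/

variable {M δ} in
lemma log_horizon_gt (hT : 2 ≤ M.T) : 1 / 2 < Real.log M.T := by
  have h1 : Real.log 2 ≤ Real.log M.T := Real.log_le_log (by norm_num) (by exact_mod_cast hT)
  have := Real.log_two_gt_d9
  linarith

variable {M δ} in
lemma confP_log_pos (hT : 2 ≤ M.T) (hδ0 : 0 < δ) (hδ1 : δ < 1) {t : ℕ} (ht : 1 ≤ t) :
    0 < Real.log (3 * t * Real.log M.T / δ) := by
  refine Real.log_pos ?_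
  rw [lt_div_iff₀ hδ0]
  have h1 := log_horizon_gt hT
  have h2 : (1 : ℝ) ≤ t := by exact_mod_cast ht
  nlinarith

variable {M δ} in
lemma confP_pos (hT : 2 ≤ M.T) (hδ0 : 0 < δ) (hδ1 : δ < 1) {t : ℕ} (ht : 1 ≤ t) (m : ℝ) :
    0 < M.confP δ t m := by
  have := confP_log_pos hT hδ0 hδ1 ht
  unfold confP
  positivity

variable {M δ} in
lemma confP_mono (hT : 2 ≤ M.T) (hδ0 : 0 < δ) (hδ1 : δ < 1) {t : ℕ} (ht : 1 ≤ t) {m m' : ℝ}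
    (hm : m ≤ m') : M.confP δ t m ≤ M.confP δ t m' := by
  have := confP_log_pos hT hδ0 hδ1 ht
  unfold confP
  gcongr

variable {M δ} in
/-- `Conf^P_t(m)` is the solution `c` of `c² = ℓ_t (2 m + c)`. -/
lemma confP_sq_div (hT : 2 ≤ M.T) (hδ0 : 0 < δ) (hδ1 : δ < 1) {t : ℕ} (ht : 1 ≤ t) {m : ℝ}
    (hm : 0 ≤ m) : M.confP δ t m ^ 2 / (2 * m + M.confP δ t m)
      = Real.log (3 * t * Real.log M.T / δ) := by
  have hl := confP_log_pos hT hδ0 hδ1 ht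
  have hc := confP_pos hT hδ0 hδ1 ht m
  rw [div_eq_iff (by positivity)]
  unfold confP
  set l := Real.log (3 * t * Real.log M.T / δ)
  have hs := Real.sq_sqrt (show 0 ≤ l ^ 2 + 8 * m * l by positivity)
  linear_combination (1 / 4) * hs

variable [Fintype Θ]

lemma arrivals_nonneg (t : ℕ) (ω : Ω) : 0 ≤ M.arrivals t ω :=
  Finset.sum_nonneg fun _ _ => Nat.cast_nonneg _

lemma arrivalsIoc_nonneg (s t : ℕ) (ω : Ω) : 0 ≤ M.arrivalsIoc s t ω :=
  Finset.sum_nonneg fun _ _ => M.arrivals_nonneg _ ω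

variable {M} in
lemma arrivalsIoc_add {ω : Ω} {r s t : ℕ} (hrs : r ≤ s) (hst : s ≤ t) :
    M.arrivalsIoc r s ω + M.arrivalsIoc s t ω = M.arrivalsIoc r t ω :=
  Finset.sum_Ioc_consecutive _ hrs hst

variable {M} in
lemma arrivalsIoc_succ {ω : Ω} {s t : ℕ} (hst : s ≤ t) :
    M.arrivalsIoc s (t + 1) ω = M.arrivalsIoc s t ω + M.arrivals (t + 1) ω :=
  Finset.sum_Ioc_succ_top hst _

variable {M} in
lemma arrivalsIoc_self {ω : Ω} (s : ℕ) : M.arrivalsIoc s s ω = 0 := by simp [arrivalsIoc]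

variable [MeasurableSpace Ω] (P : Measure Ω)

lemma meanArrivals_nonneg (s t : ℕ) : 0 ≤ M.meanArrivals P s t :=
  integral_nonneg fun ω => M.arrivalsIoc_nonneg s t ω

lemma confN_nonneg (s t : ℕ) : 0 ≤ M.confN P δ s t := Real.sqrt_nonneg _

lemma upperN_nonneg (t : ℕ) : 0 ≤ M.upperN P δ t :=
  add_nonneg (M.meanArrivals_nonneg P _ _) (M.confN_nonneg δ P _ _)

lemma mu_nonneg (X : ℝ) : 0 ≤ M.mu P δ X := Finset.sum_nonneg fun _ _ => measureReal_nonneg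

lemma eta_nonneg (t : ℕ) : 0 ≤ M.eta P δ t := Finset.sum_nonneg fun _ _ => measureReal_nonneg

lemma lowerN_self (t : ℕ) : M.lowerN P δ t t = 0 := by
  simp [lowerN, meanArrivals, arrivalsIoc, confN]

/-- A larger allocation consumes faster and so reaches each item no later. -/
lemma slowTime_anti {X Y : ℝ} (hX : 0 ≤ X) (hXY : X ≤ Y) (b : Fin M.B) :
    M.slowTime P δ 1 Y b ≤ M.slowTime P δ 1 X b := by
  refine sInf_le_sInf ?_
  rintro u ⟨t', hu, h1, h2, h3⟩
  refine ⟨t', hu, h1, h2, h3.trans ?_⟩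
  simp only [Nat.sub_self, lowerN_self, zero_mul, zero_add] at h3 ⊢
  have hb : (1 : ℝ) ≤ M.rank b := by exact_mod_cast M.rank_pos b
  -- `lowerN` may be negative in general, but not at a round where a rank, which is at least 1, has
  -- been reached.
  have : 0 ≤ M.lowerN P δ 0 t' := by
    by_contra hneg
    nlinarith
  gcongr

lemma mu_anti [IsProbabilityMeasure P] {X Y : ℝ} (hX : 0 ≤ X) (hXY : X ≤ Y) :
    M.mu P δ Y ≤ M.mu P δ X :=
  Finset.sum_le_sum fun b _ => measureReal_mono fun _ hω =>
    lt_of_lt_of_le (show _ < _ from hω) (min_le_min_left _ (M.slowTime_anti δ P hX hXY b))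

lemma eta_one_le_mu [IsProbabilityMeasure P] : M.eta P δ 1 ≤ M.mu P δ (M.xLow P δ) :=
  (Finset.sum_le_sum fun _ _ => measureReal_mono fun _ hω => hω.2).trans
    (Finset.sum_le_sum_of_subset_of_nonneg (Finset.subset_univ _)
      fun _ _ _ => measureReal_nonneg)

variable {M δ P}

lemma worstLoss_nonneg (hT : 2 ≤ M.T) (hδ0 : 0 < δ) (hδ1 : δ < 1) (X : ℝ) :
    0 ≤ M.worstLoss P δ X :=
  le_min (Nat.cast_nonneg _)
    (add_nonneg (M.mu_nonneg δ P X) (confP_pos hT hδ0 hδ1 le_rfl _).le)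

lemma worstLoss_anti [IsProbabilityMeasure P] (hT : 2 ≤ M.T) (hδ0 : 0 < δ) (hδ1 : δ < 1)
    {X Y : ℝ} (hX : 0 ≤ X) (hXY : X ≤ Y) : M.worstLoss P δ Y ≤ M.worstLoss P δ X := by
  have := M.mu_anti δ P hX hXY
  exact min_le_min_left _ (add_le_add this (confP_mono hT hδ0 hδ1 le_rfl this))

/-- The cap of `worstLoss` at `B` puts `0` into the set whose supremum is taken. -/
lemma xLow_nonneg (M : Model Θ Ω) (P : Measure Ω) (δ : ℝ) : 0 ≤ M.xLow P δ := by
  have h0 : (0 : ℝ) ∈ {X : ℝ | X ≤ (M.B - M.worstLoss P δ X) / M.upperN P δ 0} :=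
    div_nonneg (sub_nonneg.2 (min_le_left _ _)) (M.upperN_nonneg δ P 0)
  exact Real.sSup_nonneg' ⟨0, h0, le_rfl⟩

/-- The lower guardrail is a fixed point: it exhausts the budget that the pessimistic forecast of
the perishing leaves for the pessimistic forecast of the arrivals. -/
lemma xLow_mul_upperN [IsProbabilityMeasure P] (hT : 2 ≤ M.T) (hδ0 : 0 < δ) (hδ1 : δ < 1)
    (hN : 0 < M.upperN P δ 0) :
    M.xLow P δ * M.upperN P δ 0 + M.worstLoss P δ (M.xLow P δ) = M.B := by
  set f : ℝ → ℝ := fun X => (M.B - M.worstLoss P δ X) / M.upperN P δ 0 with hf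
  set S : Set ℝ := {X | X ≤ f X} with hS
  have hx : M.xLow P δ = sSup S := rfl
  have hx0 := M.xLow_nonneg P δ
  have hf0 : ∀ X, 0 ≤ f X := fun X => div_nonneg (sub_nonneg.2 (min_le_left _ _)) hN.le
  have hmono : ∀ X Y, 0 ≤ X → X ≤ Y → f X ≤ f Y := fun X Y hX hXY => by
    have := worstLoss_anti (P := P) hT hδ0 hδ1 hX hXY
    simp only [hf]
    gcongr
  have hbdd : BddAbove S := ⟨M.B / M.upperN P δ 0, fun X hX => (show X ≤ f X from hX).trans (by
    have := worstLoss_nonneg (P := P) hT hδ0 hδ1 X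
    simp only [hf]
    gcongr
    linarith)⟩
  -- `f` may jump, so the argument is that of Knaster and Tarski: monotonicity gives `sSup S ≤ f
  -- (sSup S)`, and then `f (sSup S)` itself belongs to `S`.
  have h1 : M.xLow P δ ≤ f (M.xLow P δ) := by
    rw [hx]
    refine csSup_le ⟨0, hf0 0⟩ fun X hX => ?_
    rcases le_total 0 X with h | h
    · exact (show X ≤ f X from hX).trans (hmono _ _ h (le_csSup hbdd hX))
    · exact h.trans (hf0 _)
  have h2 : f (M.xLow P δ) ≤ M.xLow P δ := by
    conv_rhs => rw [hx]
    exact le_csSup hbdd (hmono _ _ hx0 h1)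
  have h3 := le_antisymm h1 h2
  rw [eq_div_iff hN.ne'] at h3
  linarith

lemma upperN_mul_perishLoss [IsProbabilityMeasure P] (hT : 2 ≤ M.T) (hδ0 : 0 < δ) (hδ1 : δ < 1)
    (hN : 0 < M.upperN P δ 0) :
    M.upperN P δ 0 * M.perishLoss P δ = M.worstLoss P δ (M.xLow P δ) := by
  have := xLow_mul_upperN (P := P) hT hδ0 hδ1 hN
  rw [perishLoss, mul_sub, mul_div_cancel₀ _ hN.ne']
  linarith

/-- The forecasts decrease in `t`, and already the first is below the worst loss because `η_1 ≤
μ(xLow)`. -/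
lemma perishForecast_le_worstLoss [IsProbabilityMeasure P] (hT : 2 ≤ M.T) (hδ0 : 0 < δ)
    (hδ1 : δ < 1) {t : ℕ} (ht : 1 ≤ t) :
    M.perishForecast P δ t ≤ M.worstLoss P δ (M.xLow P δ) := by
  induction t, ht using Nat.le_induction with
  | base =>
    have := M.eta_one_le_mu δ P
    exact min_le_min_left _ (add_le_add this (confP_mono hT hδ0 hδ1 le_rfl this))
  | succ t _ ih => exact (min_le_left _ _).trans ih

end Forecast

section Good

variable {Θ Ω : Type*} [Fintype Θ] [MeasurableSpace Ω]

/-! ### Outcomes on which the forecasts are correct -/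

/-- The items that the slow consumption process, started in round `t`, loses. -/
noncomputable def slowLost (M : Model Θ Ω) (P : Measure Ω) (δ : ℝ) (t : ℕ) (ω : Ω) :
    Finset (Fin M.B) := by
  classical
  exact (M.slowItems P δ t (M.xLow P δ)).filter fun b => t ≤ M.perish b ω ∧
    (M.perish b ω : ℕ∞) < min (M.T : ℕ∞) (M.slowTime P δ t (M.xLow P δ) b)

/-- The outcome `ω` respects all confidence bounds. -/
structure Good (M : Model Θ Ω) (P : Measure Ω) (δ : ℝ) (ω : Ω) : Prop where
  one_le_arrivals : ∀ t ∈ Finset.Icc 1 M.T, 1 ≤ M.arrivals t ω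
  abs_arrivals_sub_le : ∀ s t, s ≤ t → t ≤ M.T →
    |M.arrivalsIoc s t ω - M.meanArrivals P s t| ≤ M.confN P δ s t
  card_slowLost_le : ∀ t ∈ Finset.Icc 1 M.T,
    ((M.slowLost P δ t ω).card : ℝ) ≤ M.eta P δ t + M.confP δ t (M.eta P δ t)

/-- The algorithm does not run out of budget in round `t`. -/
def Served (M : Model Θ Ω) (P : Measure Ω) (δ L : ℝ) (t : ℕ) (ω : Ω) : Prop :=
  M.arrivals t ω * M.xLow P δ ≤ M.budget P δ L t ω

variable {M : Model Θ Ω} {P : Measure Ω} {δ L : ℝ} {ω : Ω}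

lemma Good.lowerN_le (h : M.Good P δ ω) {s t : ℕ} (hst : s ≤ t) (ht : t ≤ M.T) :
    M.lowerN P δ s t ≤ M.arrivalsIoc s t ω := by
  have := (abs_le.1 (h.abs_arrivals_sub_le s t hst ht)).1
  rw [lowerN]
  linarith

lemma Good.le_upperN (h : M.Good P δ ω) {s : ℕ} (hs : s ≤ M.T) :
    M.arrivalsIoc s M.T ω ≤ M.upperN P δ s := by
  have := (abs_le.1 (h.abs_arrivals_sub_le s M.T hs le_rfl)).2
  rw [upperN]
  linarith

lemma Good.upperN_le (h : M.Good P δ ω) {s : ℕ} (hs : s ≤ M.T) :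
    M.upperN P δ s ≤ M.arrivalsIoc s M.T ω + 2 * M.confN P δ s M.T := by
  have := (abs_le.1 (h.abs_arrivals_sub_le s M.T hs le_rfl)).1
  rw [upperN]
  linarith

lemma Good.sub_le_arrivalsIoc (h : M.Good P δ ω) {s t : ℕ} (hst : s ≤ t) (ht : t ≤ M.T) :
    (t : ℝ) - s ≤ M.arrivalsIoc s t ω := by
  have : ∑ _r ∈ Finset.Ioc s t, (1 : ℝ) ≤ M.arrivalsIoc s t ω :=
    Finset.sum_le_sum fun r hr => h.one_le_arrivals r (by
      simp only [Finset.mem_Ioc, Finset.mem_Icc] at hr ⊢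
      omega)
  simpa [Nat.cast_sub hst] using this

lemma Good.perishForecast_nonneg (h : M.Good P δ ω) {t : ℕ} (ht : t ≤ M.T) :
    0 ≤ M.perishForecast P δ t := by
  induction t with
  | zero => exact Nat.cast_nonneg _
  | succ t ih =>
    exact le_min (ih (by omega))
      ((Nat.cast_nonneg _).trans (h.card_slowLost_le (t + 1) (by simp; omega)))

lemma decision_of_served {t : ℕ} (hs : M.Served P δ L t ω) :
    M.decision P δ L t (M.budget P δ L t ω) ω = M.xUp P δ L ∧
        M.xLow P δ * M.upperN P δ t + M.perishForecast P δ t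
          ≤ M.budget P δ L t ω - M.arrivals t ω * M.xUp P δ L ∨
      M.decision P δ L t (M.budget P δ L t ω) ω = M.xLow P δ ∧
        M.budget P δ L t ω - M.arrivals t ω * M.xUp P δ L
          < M.xLow P δ * M.upperN P δ t + M.perishForecast P δ t := by
  rw [decision, if_neg (not_lt.2 hs)]
  split_ifs with h
  · exact Or.inl ⟨rfl, h⟩
  · exact Or.inr ⟨rfl, not_le.1 h⟩

lemma xLow_le_xUp (hL : 0 ≤ L) : M.xLow P δ ≤ M.xUp P δ L := le_add_of_nonneg_right hL

lemma xLow_le_decision (hL : 0 ≤ L) {t : ℕ} (hs : M.Served P δ L t ω) :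
    M.xLow P δ ≤ M.decision P δ L t (M.budget P δ L t ω) ω := by
  rcases decision_of_served hs with ⟨h, _⟩ | ⟨h, _⟩ <;> rw [h]
  exact xLow_le_xUp hL

lemma decision_le_xUp (hL : 0 ≤ L) {t : ℕ} (hs : M.Served P δ L t ω) :
    M.decision P δ L t (M.budget P δ L t ω) ω ≤ M.xUp P δ L := by
  rcases decision_of_served hs with ⟨h, _⟩ | ⟨h, _⟩ <;> rw [h]
  exact xLow_le_xUp hL

lemma arrivals_mul_xLow_le_amount (hL : 0 ≤ L) {t : ℕ} (hs : M.Served P δ L t ω) :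
    M.arrivals t ω * M.xLow P δ ≤ M.amount P δ L t ω :=
  mul_le_mul_of_nonneg_left (xLow_le_decision hL hs) (M.arrivals_nonneg t ω)

lemma amount_nonneg (hL : 0 ≤ L) {t : ℕ} (hs : M.Served P δ L t ω) :
    0 ≤ M.amount P δ L t ω :=
  (mul_nonneg (M.arrivals_nonneg t ω) (M.xLow_nonneg P δ)).trans
    (arrivals_mul_xLow_le_amount hL hs)

lemma Good.amount_le_budget (h : M.Good P δ ω) {t : ℕ} (ht : t ≤ M.T)
    (hs : M.Served P δ L t ω) : M.amount P δ L t ω ≤ M.budget P δ L t ω := by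
  rw [amount]
  rcases decision_of_served hs with ⟨hd, hc⟩ | ⟨hd, _⟩ <;> rw [hd]
  · have := h.perishForecast_nonneg ht
    have := mul_nonneg (M.xLow_nonneg P δ) (M.upperN_nonneg δ P t)
    linarith
  · exact hs

lemma xLow_mul_arrivalsIoc_le_sum_amount (hL : 0 ≤ L) {t : ℕ}
    (hs : ∀ r ∈ Finset.Ioc 0 t, M.Served P δ L r ω) :
    M.xLow P δ * M.arrivalsIoc 0 t ω ≤ ∑ r ∈ Finset.Ioc 0 t, M.amount P δ L r ω := by
  rw [mul_comm, arrivalsIoc, Finset.sum_mul]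
  exact Finset.sum_le_sum fun r hr => arrivals_mul_xLow_le_amount hL (hs r hr)

/-- An item of which the algorithm loses something before the horizon is also lost by the slow
consumption process. -/
lemma Good.mem_slowLost (h : M.Good P δ ω) (hL : 0 ≤ L) {s u : ℕ} (hs1 : 1 ≤ s) (hsu : s ≤ u)
    (hu : u < M.T) (hs : ∀ r ∈ Finset.Ioc 0 u, M.Served P δ L r ω) {b : Fin M.B}
    (hb : M.perish b ω = u) (hres : 0 < M.residual P δ L u ω b) : b ∈ M.slowLost P δ s ω := by
  have hx := M.xLow_nonneg P δ
  have hlt : ∀ t' ≤ u, M.xLow P δ * M.arrivalsIoc 0 t' ω < M.rank b := fun t' ht' =>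
    calc M.xLow P δ * M.arrivalsIoc 0 t' ω ≤ M.xLow P δ * M.arrivalsIoc 0 u ω := by
          rw [← arrivalsIoc_add (Nat.zero_le t') ht']
          have := M.arrivalsIoc_nonneg t' u ω
          gcongr
          linarith
      _ ≤ _ := xLow_mul_arrivalsIoc_le_sum_amount hL hs
      _ < _ := sum_amount_lt_rank (hs1.trans hsu) (fun r hr => amount_nonneg hL (hs r hr)) hres
  have hlow := h.lowerN_le (Nat.zero_le (s - 1)) (by omega)
  simp only [slowLost, slowItems, Finset.mem_filter, Finset.mem_univ, true_and, hb]
  refine ⟨?_, hsu, lt_min (by exact_mod_cast hu) ?_⟩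
  · rw [Int.ceil_le]
    have := hlt (s - 1) (by omega)
    push_cast
    nlinarith
  -- Had the slow process reached `b` at some `t' ≤ u`, the true arrivals, which are at least as
  -- many, would have consumed the full rank of `b` by then, against `hlt`.
  · refine lt_of_not_ge fun hle => ?_
    have hlt' : M.slowTime P δ s (M.xLow P δ) b < ((u + 1 : ℕ) : ℕ∞) :=
      hle.trans_lt (by exact_mod_cast u.lt_succ_self)
    obtain ⟨_, ⟨t', rfl, h1, h2, h3⟩, h4⟩ := sInf_lt_iff.1 hlt'
    have h4 : t' < u + 1 := by exact_mod_cast h4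
    have h5 := h.lowerN_le (show s - 1 ≤ t' by omega) h2
    have h6 := hlt t' (by omega)
    rw [← arrivalsIoc_add (Nat.zero_le (s - 1)) (show s - 1 ≤ t' by omega)] at h6
    nlinarith

lemma sum_loss_eq (s u : ℕ) : ∑ r ∈ Finset.Ioc s u, M.loss P δ L r ω
    = ∑ b, if M.perish b ω ∈ Finset.Ioc s u then M.residual P δ L (M.perish b ω) ω b else 0 := by
  simp only [loss]
  rw [Finset.sum_comm]
  exact Finset.sum_congr rfl fun b _ => Finset.sum_ite_eq _ _ _

lemma sum_loss_le_budget (s u : ℕ) : ∑ r ∈ Finset.Ioc s u, M.loss P δ L r ω ≤ M.B := by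
  rw [sum_loss_eq]
  calc _ ≤ ∑ _b : Fin M.B, (1 : ℝ) := by
        refine Finset.sum_le_sum fun b _ => ?_
        split_ifs
        · exact M.residual_le_one P δ L _ ω b
        · exact zero_le_one
    _ = M.B := by simp

/-- Every item accounts for at most one unit of loss, and only items of `slowLost` contribute.
Losses after round `s` are compared with the process started in round `s + 1`. -/
lemma Good.sum_loss_le_card (h : M.Good P δ ω) (hL : 0 ≤ L) {s u : ℕ} (hu : u < M.T)
    (hs : ∀ r ∈ Finset.Ioc 0 u, M.Served P δ L r ω) :
    ∑ r ∈ Finset.Ioc s u, M.loss P δ L r ω ≤ (M.slowLost P δ (s + 1) ω).card := by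
  classical
  rw [sum_loss_eq, Finset.cast_card, ← Finset.sum_filter_add_sum_filter_not Finset.univ
    (fun b => b ∈ M.slowLost P δ (s + 1) ω)]
  rw [Finset.filter_mem_eq_inter, Finset.univ_inter]
  refine (add_le_add (Finset.sum_le_sum fun b _ => ?_)
    (Finset.sum_nonpos fun b hb => ?_)).trans_eq (add_zero _)
  · split_ifs
    · exact M.residual_le_one P δ L _ ω b
    · exact zero_le_one
  · split_ifs with hp
    · by_contra! hres
      rw [Finset.mem_Ioc] at hp
      refine (Finset.mem_filter.1 hb).2 (h.mem_slowLost hL (Nat.le_add_left 1 s) hp.1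
        (hp.2.trans_lt hu) (fun r hr => hs r ?_) rfl hres)
      exact Finset.Ioc_subset_Ioc_right hp.2 hr
    · exact le_rfl

/-- The forecast is a running minimum; its older entries bound the loss over a longer window and so
remain valid. Round `T` is excluded because what perishes there can no longer harm service. -/
lemma Good.sum_loss_le_perishForecast (h : M.Good P δ ω) (hL : 0 ≤ L) {u : ℕ} (hu : u < M.T)
    (hs : ∀ r ∈ Finset.Ioc 0 u, M.Served P δ L r ω) {t : ℕ} (ht : t ≤ M.T) :
    ∑ r ∈ Finset.Ioc (t - 1) u, M.loss P δ L r ω ≤ M.perishForecast P δ t := by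
  induction t with
  | zero => exact sum_loss_le_budget _ _
  | succ t ih =>
    refine le_min ((Finset.sum_le_sum_of_subset_of_nonneg ?_ fun r _ _ =>
      M.loss_nonneg P δ L r ω).trans (ih (by omega))) ?_
    · exact Finset.Ioc_subset_Ioc_left (by omega)
    · exact (h.sum_loss_le_card hL hu hs).trans (h.card_slowLost_le (t + 1) (by simp; omega))

lemma Good.upperN_pos (h : M.Good P δ ω) (hT : 2 ≤ M.T) : 0 < M.upperN P δ 0 := by
  have h1 := h.sub_le_arrivalsIoc (Nat.zero_le M.T) le_rfl
  have h2 := h.le_upperN (Nat.zero_le M.T)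
  have h3 : (2 : ℝ) ≤ M.T := by exact_mod_cast hT
  push_cast at h1
  linarith

/-! ### Feasibility of the guardrails and the unallocated budget -/

variable [IsProbabilityMeasure P]

lemma Good.sum_loss_le_worstLoss (h : M.Good P δ ω) (hL : 0 ≤ L) (hT : 2 ≤ M.T) (hδ0 : 0 < δ)
    (hδ1 : δ < 1) {u : ℕ} (hu : u < M.T) (hs : ∀ r ∈ Finset.Ioc 0 u, M.Served P δ L r ω) :
    ∑ r ∈ Finset.Ioc 0 u, M.loss P δ L r ω ≤ M.worstLoss P δ (M.xLow P δ) :=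
  (h.sum_loss_le_perishForecast hL hu hs (t := 1) (by omega)).trans
    (perishForecast_le_worstLoss hT hδ0 hδ1 le_rfl)

/-- The algorithm never runs out of budget: at the beginning of each round the budget suffices
for the pessimistic forecasts that were made in some earlier round. -/
lemma Good.served_aux (h : M.Good P δ ω) (hL : 0 ≤ L) (hT : 2 ≤ M.T) (hδ0 : 0 < δ)
    (hδ1 : δ < 1) {t : ℕ} (ht : t ≤ M.T) :
    (∀ r ∈ Finset.Ioc 0 t, M.Served P δ L r ω) ∧ ∃ s ≤ t, ∃ F : ℝ,
      (∀ u < M.T, (∀ r ∈ Finset.Ioc 0 u, M.Served P δ L r ω) →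
        ∑ r ∈ Finset.Ioc (s - 1) u, M.loss P δ L r ω ≤ F) ∧
      M.xLow P δ * (M.upperN P δ s - M.arrivalsIoc s t ω) + F
        - ∑ r ∈ Finset.Ioc (s - 1) t, M.loss P δ L r ω ≤ ∑ b, M.stock P δ L t ω b := by
  have hx := M.xLow_nonneg P δ
  induction t with
  | zero =>
    -- `s` is the last round that granted the upper guardrail, or 0 if there is none; `F` is the
    -- perishing forecast in force since then.
    refine ⟨by simp, 0, le_rfl, M.worstLoss P δ (M.xLow P δ),
      fun u hu hs => h.sum_loss_le_worstLoss hL hT hδ0 hδ1 hu hs, ?_⟩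
    have := xLow_mul_upperN (P := P) hT hδ0 hδ1 (h.upperN_pos hT)
    rw [sum_stock_zero, arrivalsIoc_self]
    simp
    linarith
  | succ t ih =>
    obtain ⟨hs, s, hst, F, hF, hstock⟩ := ih (by omega)
    have hserved : M.Served P δ L (t + 1) ω := by
      -- The loss bound is conditional on service up to `t`, which the induction supplies; this
      -- breaks the circle between service and small losses. What remains covers `xLow` for the
      -- forecast arrivals, including those of round `t + 1`.
      have h1 := hF t (by omega) hs
      have h2 := h.le_upperN (s := s) (by omega)
      rw [← arrivalsIoc_add (show s ≤ t + 1 by omega) ht, arrivalsIoc_succ hst] at h2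
      have h3 := M.arrivalsIoc_nonneg (t + 1) M.T ω
      rw [Served, budget_succ, mul_comm]
      nlinarith
    refine ⟨fun r hr => ?_, ?_⟩
    · rcases (Finset.mem_Ioc.1 hr).2.eq_or_lt with rfl | hlt
      · exact hserved
      · exact hs r (Finset.mem_Ioc.2 ⟨(Finset.mem_Ioc.1 hr).1, by omega⟩)
    · have hbal := sum_stock_succ (amount_nonneg hL hserved) (h.amount_le_budget ht hserved)
      rcases decision_of_served hserved with ⟨hd, hc⟩ | ⟨hd, _⟩
      -- The passed test is the invariant for `s = t + 1`. The loss window starts at `t` because the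
      -- perishing of round `t + 1` happens after its allocation.
      · refine ⟨t + 1, le_rfl, M.perishForecast P δ (t + 1),
          fun u hu hs => h.sum_loss_le_perishForecast hL hu hs ht, ?_⟩
        rw [hbal, amount, hd, arrivalsIoc_self]
        rw [budget_succ] at hc
        simp
        linarith
      -- Under the lower guardrail both sides drop by `xLow` times the arrivals, plus the loss of
      -- the round.
      · refine ⟨s, by omega, F, hF, ?_⟩
        rw [hbal, amount, hd, arrivalsIoc_succ hst, Finset.sum_Ioc_succ_top (by omega)]
        linarith

lemma Good.served (h : M.Good P δ ω) (hL : 0 ≤ L) (hT : 2 ≤ M.T) (hδ0 : 0 < δ)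
    (hδ1 : δ < 1) {t : ℕ} (ht : t ∈ Finset.Icc 1 M.T) : M.Served P δ L t ω :=
  (h.served_aux hL hT hδ0 hδ1 le_rfl).1 t (by
    simp only [Finset.mem_Ioc, Finset.mem_Icc] at ht ⊢
    omega)

/-- The budget that is unallocated after round `t` is either left on the table or lost. -/
lemma Good.sum_stock_eq (h : M.Good P δ ω) (hL : 0 ≤ L) (hT : 2 ≤ M.T) (hδ0 : 0 < δ)
    (hδ1 : δ < 1) {t : ℕ} (ht : t ≤ M.T) :
    ∑ b, M.stock P δ L t ω b = M.B - ∑ r ∈ Finset.Ioc 0 t, M.amount P δ L r ω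
      - ∑ r ∈ Finset.Ioc 0 t, M.loss P δ L r ω := by
  induction t with
  | zero => simp [stock]
  | succ t ih =>
    have hs := h.served hL hT hδ0 hδ1 (t := t + 1) (by simp; omega)
    rw [sum_stock_succ (amount_nonneg hL hs) (h.amount_le_budget ht hs), ih (by omega),
      Finset.sum_Ioc_succ_top (Nat.zero_le t), Finset.sum_Ioc_succ_top (Nat.zero_le t)]
    ring

/-- After the last round in which the lower guardrail is used, the unallocated budget drops at
the rate of the upper guardrail. -/
lemma Good.exists_unallocated_le (h : M.Good P δ ω) (hL : 0 ≤ L) (hT : 2 ≤ M.T) (hδ0 : 0 < δ)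
    (hδ1 : δ < 1) {n : ℝ} (hn0 : 0 ≤ n) (hn : ∀ t ∈ Finset.Icc 1 M.T, M.arrivals t ω ≤ n)
    {t : ℕ} (ht : t ≤ M.T) :
    ∃ s ≤ t, M.B - ∑ r ∈ Finset.Ioc 0 t, M.amount P δ L r ω
      ≤ 2 * M.worstLoss P δ (M.xLow P δ) + n * L + M.xLow P δ * M.upperN P δ s
        - M.xUp P δ L * M.arrivalsIoc s t ω := by
  induction t with
  | zero =>
    refine ⟨0, le_rfl, ?_⟩
    have h1 := xLow_mul_upperN (P := P) hT hδ0 hδ1 (h.upperN_pos hT)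
    have h2 := worstLoss_nonneg (M := M) (P := P) hT hδ0 hδ1 (M.xLow P δ)
    have h3 := mul_nonneg hn0 hL
    rw [arrivalsIoc_self]
    simp
    linarith
  | succ t ih =>
    have hmem : t + 1 ∈ Finset.Icc 1 M.T := by simp; omega
    have hs := h.served hL hT hδ0 hδ1 hmem
    rw [Finset.sum_Ioc_succ_top (Nat.zero_le t)]
    rcases decision_of_served hs with ⟨hd, _⟩ | ⟨hd, hc⟩
    · obtain ⟨s, hst, hle⟩ := ih (by omega)
      refine ⟨s, by omega, ?_⟩
      rw [amount, hd, arrivalsIoc_succ hst]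
      linarith
    -- The failed test bounds the current budget. Past losses and the forecast each cost at most one
    -- `worstLoss`, and `n * L` pays for testing with `xUp` while granting `xLow`.
    · refine ⟨t + 1, le_rfl, ?_⟩
      have h1 := h.sum_stock_eq hL hT hδ0 hδ1 (t := t) (by omega)
      have h2 := h.sum_loss_le_worstLoss hL hT hδ0 hδ1 (u := t) (by omega)
        fun r hr => h.served hL hT hδ0 hδ1 (by
          simp only [Finset.mem_Ioc, Finset.mem_Icc] at hr ⊢
          omega)
      have h3 := perishForecast_le_worstLoss (M := M) (P := P) hT hδ0 hδ1 (Nat.le_add_left 1 t)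
      have h4 : M.arrivals (t + 1) ω * L ≤ n * L := by
        have := hn _ hmem
        gcongr
      rw [budget_succ, h1] at hc
      rw [amount, hd, arrivalsIoc_self]
      simp only [xUp] at hc ⊢
      linarith

end Good

section Probability

variable {Θ Ω : Type*} {M : Model Θ Ω} {δ : ℝ}

/-! ### The confidence bounds hold with high probability -/

lemma log_two_mul_sq_div_pos (hT : 2 ≤ M.T) (hδ0 : 0 < δ) (hδ1 : δ < 1) :
    0 < Real.log (2 * (M.T : ℝ) ^ 2 / δ) := by
  have : (2 : ℝ) ≤ M.T := by exact_mod_cast hT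
  refine Real.log_pos ?_
  rw [lt_div_iff₀ hδ0]
  nlinarith

/-- The harmonic sum is at most `1 + log T`, and `1 ≤ 2 log T`; this matches the 3 in `confP`. -/
lemma sum_inv_le_three_mul_log (hT : 2 ≤ M.T) :
    ∑ t ∈ Finset.Icc 1 M.T, (t : ℝ)⁻¹ ≤ 3 * Real.log M.T := by
  have h := harmonic_le_one_add_log M.T
  rw [harmonic_eq_sum_Icc] at h
  push_cast at h
  have := log_horizon_gt hT
  linarith

variable [MeasurableSpace Ω] {P : Measure Ω}

lemma rho_nonneg (M : Model Θ Ω) (P : Measure Ω) (t : ℕ) (θ : Θ) : 0 ≤ M.rho P t θ :=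
  ENNReal.toReal_nonneg

lemma Admissible.integrable_arr [IsProbabilityMeasure P] (hM : M.Admissible P) {t : ℕ} (ht : t ∈ Finset.Icc 1 M.T)
    (θ : Θ) : Integrable (fun ω => (M.arr t θ ω : ℝ)) P :=
  (hM.bounded_arr t ht θ).integrable le_top

lemma rhoMax_nonneg (M : Model Θ Ω) (P : Measure Ω) : 0 ≤ M.rhoMax P :=
  Real.iSup_nonneg fun p => M.rho_nonneg P p.1 p.2

variable [Fintype Θ]

lemma Admissible.ae_one_le_arrivals [Nonempty Θ] (hM : M.Admissible P) :
    ∀ᵐ ω ∂P, ∀ t ∈ Finset.Icc 1 M.T, 1 ≤ M.arrivals t ω := by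
  refine (ae_ball_iff (Finset.Icc 1 M.T).countable_toSet).2 fun t ht => ?_
  obtain ⟨θ⟩ := ‹Nonempty Θ›
  filter_upwards [hM.one_le_arr t ht θ] with ω hω
  exact (show (1 : ℝ) ≤ M.arr t θ ω by exact_mod_cast hω).trans
    (Finset.single_le_sum (f := fun θ => (M.arr t θ ω : ℝ)) (fun _ _ => Nat.cast_nonneg _)
      (Finset.mem_univ θ))

lemma rho_le_rhoMax {t : ℕ} (ht : t ∈ Finset.Icc 1 M.T) (θ : Θ) :
    M.rho P t θ ≤ M.rhoMax P :=
  le_ciSup (f := fun p : Finset.Icc 1 M.T × Θ => M.rho P p.1 p.2)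
    (Set.finite_range _).bddAbove (⟨t, ht⟩, θ)

variable [IsProbabilityMeasure P]

lemma Admissible.integrable_arrivals (hM : M.Admissible P) {t : ℕ}
    (ht : t ∈ Finset.Icc 1 M.T) : Integrable (M.arrivals t) P :=
  integrable_finsetSum _ fun θ _ => hM.integrable_arr ht θ

lemma Admissible.abs_arr_sub_le (hM : M.Admissible P) {t : ℕ} (ht : t ∈ Finset.Icc 1 M.T)
    (θ : Θ) : ∀ᵐ ω ∂P, |(M.arr t θ ω : ℝ) - ∫ ω', (M.arr t θ ω' : ℝ) ∂P| ≤ M.rhoMax P := by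
  have hmem : MemLp (fun ω => (M.arr t θ ω : ℝ) - ∫ ω', (M.arr t θ ω' : ℝ) ∂P) ⊤ P :=
    (hM.bounded_arr t ht θ).sub (memLp_const _)
  -- Boundedness makes the essential supremum finite, so `toReal` in `rho` does not collapse it to
  -- 0.
  have hfin := hmem.eLpNorm_ne_top
  rw [eLpNorm_exponent_top] at hfin
  filter_upwards [ae_le_eLpNormEssSup (μ := P)
    (f := fun ω => (M.arr t θ ω : ℝ) - ∫ ω', (M.arr t θ ω' : ℝ) ∂P)] with ω hω
  have := ENNReal.toReal_mono hfin hω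
  rw [toReal_enorm, Real.norm_eq_abs] at this
  exact this.trans (rho_le_rhoMax ht θ)

lemma Admissible.meanArrivals_eq (hM : M.Admissible P) {s t : ℕ} (ht : t ≤ M.T) :
    M.meanArrivals P s t = ∑ r ∈ Finset.Ioc s t, ∑ θ, ∫ ω, (M.arr r θ ω : ℝ) ∂P := by
  have hmem : ∀ r ∈ Finset.Ioc s t, r ∈ Finset.Icc 1 M.T := fun r hr => by
    simp only [Finset.mem_Ioc, Finset.mem_Icc] at hr ⊢
    omega
  simp only [meanArrivals, arrivalsIoc]
  rw [integral_finsetSum _ fun r hr => hM.integrable_arrivals (hmem r hr)]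
  refine Finset.sum_congr rfl fun r hr => ?_
  simp only [arrivals]
  exact integral_finsetSum _ fun θ _ => hM.integrable_arr (hmem r hr) θ

/-- Hoeffding for `(t - s) |Θ|` variables with `l = log (2T² / δ)`, for which `2 exp (-l) = δ / T²`.
-/
lemma Admissible.measureReal_confN_lt_le (hM : M.Admissible P) (hT : 2 ≤ M.T) (hδ0 : 0 < δ)
    (hδ1 : δ < 1) {s t : ℕ} (hst : s ≤ t) (ht : t ≤ M.T) :
    P.real {ω | M.confN P δ s t < |M.arrivalsIoc s t ω - M.meanArrivals P s t|}
      ≤ δ / (M.T : ℝ) ^ 2 := by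
  have hmem : ∀ r ∈ Finset.Ioc s t, r ∈ Finset.Icc 1 M.T := fun r hr => by
    simp only [Finset.mem_Ioc, Finset.mem_Icc] at hr ⊢
    omega
  set I : Finset (Finset.Icc 1 M.T × Θ) :=
    (Finset.Ioc s t).subtype (· ∈ Finset.Icc 1 M.T) ×ˢ Finset.univ with hI
  have hsum : ∀ f : ℕ → Θ → ℝ, ∑ p ∈ I, f p.1 p.2 = ∑ r ∈ Finset.Ioc s t, ∑ θ, f r θ := fun f => by
    rw [hI, Finset.sum_product]
    exact Finset.sum_subtype_of_mem (fun r => ∑ θ, f r θ) hmem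
  have hcard : (I.card : ℝ) = ((t : ℝ) - s) * Fintype.card Θ := by
    have := hsum fun _ _ => 1
    simpa [Nat.cast_sub hst] using this
  have hind : iIndepFun (fun (p : Finset.Icc 1 M.T × Θ) ω => (M.arr p.1 p.2 ω : ℝ)) P :=
    hM.indep_arr.comp (fun _ n => (n : ℝ)) fun _ => measurable_from_top
  have h := measureReal_abs_sum_sub_integral_le
    (X := fun (p : Finset.Icc 1 M.T × Θ) ω => (M.arr p.1 p.2 ω : ℝ))
    (fun p => measurable_from_top.comp (hM.measurable_arr p.1 p.1.2 p.2)) hind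
    (M.rhoMax_nonneg P) (fun p => hM.abs_arr_sub_le p.1.2 p.2) I
    (log_two_mul_sq_div_pos hT hδ0 hδ1).le
  have hT' : (0 : ℝ) < M.T := by exact_mod_cast (by omega : 0 < M.T)
  rw [Real.exp_neg, Real.exp_log (by positivity), hcard] at h
  refine le_of_eq_of_le ?_ (h.trans_eq (by field_simp))
  congr 1
  ext ω
  simp only [Set.mem_ofPred_eq, confN]
  rw [hsum fun r θ => (M.arr r θ ω : ℝ) - ∫ ω', (M.arr r θ ω' : ℝ) ∂P, hM.meanArrivals_eq ht]
  simp only [Finset.sum_sub_distrib, arrivalsIoc, arrivals]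
  rw [show ∀ a b c d : ℝ, 2 * (a * b * c) * d = 2 * a * b * c * d by intros; ring]

/-- Membership in `slowLost` depends only on the item's own perishing time, so its cardinality is a
sum of independent indicators with mean `eta`. By `confP_sq_div` the Chernoff exponent is exactly
the logarithm in `confP`. -/
lemma Admissible.measureReal_confP_lt_le (hM : M.Admissible P) (hT : 2 ≤ M.T) (hδ0 : 0 < δ)
    (hδ1 : δ < 1) {t : ℕ} (ht : 1 ≤ t) :
    P.real {ω | M.eta P δ t + M.confP δ t (M.eta P δ t) < (M.slowLost P δ t ω).card}
      ≤ δ / (3 * Real.log M.T) * (t : ℝ)⁻¹ := by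
  classical
  set D : Fin M.B → Set ℕ := fun b => {n | t ≤ n ∧
    (n : ℕ∞) < min (M.T : ℕ∞) (M.slowTime P δ t (M.xLow P δ) b)} with hD
  have hind : iIndepFun (fun b => (M.perish b ⁻¹' D b).indicator (fun _ => (1 : ℝ))) P :=
    hM.indep_perish.comp (fun b => (D b).indicator fun _ => (1 : ℝ)) fun _ => measurable_from_top
  have h := measureReal_sum_indicator_ge_le
    (fun b => hM.measurable_perish b (MeasurableSpace.measurableSet_top (s := D b))) hind
    (M.slowItems P δ t (M.xLow P δ)) (confP_pos hT hδ0 hδ1 ht (M.eta P δ t))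
  have heta : ∑ b ∈ M.slowItems P δ t (M.xLow P δ), P.real (M.perish b ⁻¹' D b)
    = M.eta P δ t := rfl
  have hlog := log_horizon_gt hT
  have ht' : (0 : ℝ) < t := by exact_mod_cast ht
  rw [heta, confP_sq_div hT hδ0 hδ1 ht (M.eta_nonneg δ P t), Real.exp_neg,
    Real.exp_log (by positivity)] at h
  refine (measureReal_mono fun ω hω => ?_).trans (h.trans_eq (by field_simp))
  refine (Set.mem_ofPred.1 hω).le.trans_eq ?_
  rw [slowLost, Finset.card_filter]
  push_cast
  refine Finset.sum_congr rfl fun b _ => ?_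
  simp [Set.indicator_apply, hD]

theorem Admissible.measureReal_not_good_le [Nonempty Θ] (hM : M.Admissible P) (hT : 2 ≤ M.T)
    (hδ0 : 0 < δ) (hδ1 : δ < 1) : P.real {ω | ¬ M.Good P δ ω} ≤ 2 * δ := by
  set Z : Set Ω := {ω | ¬ ∀ t ∈ Finset.Icc 1 M.T, 1 ≤ M.arrivals t ω} with hZ
  set A : ℕ × ℕ → Set Ω := fun p =>
    {ω | p.1 ≤ p.2 ∧ M.confN P δ p.1 p.2 < |M.arrivalsIoc p.1 p.2 ω - M.meanArrivals P p.1 p.2|}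
    with hA
  set C : ℕ → Set Ω := fun t =>
    {ω | M.eta P δ t + M.confP δ t (M.eta P δ t) < (M.slowLost P δ t ω).card} with hC
  -- There are `T²` pairs, each of probability at most `δ / T²`. Pairs with `s > t` give the empty
  -- set, and windows with `s = t` hold trivially.
  set I := Finset.range M.T ×ˢ Finset.Icc 1 M.T with hI
  have hsub : {ω | ¬ M.Good P δ ω}
      ⊆ Z ∪ ((⋃ p ∈ I, A p) ∪ ⋃ t ∈ Finset.Icc 1 M.T, C t) := fun ω hω => by
    by_contra hnot
    simp only [Set.mem_union, Set.mem_iUnion, not_or, not_exists] at hnot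
    obtain ⟨h1, h2, h3⟩ := hnot
    refine hω ⟨not_not.1 h1, fun s t hst ht => ?_, fun t ht => not_lt.1 (h3 t ht)⟩
    rcases hst.eq_or_lt with rfl | hlt
    · simp [arrivalsIoc, meanArrivals, confN]
    · have hmem : (s, t) ∈ I := by
        simp only [hI, Finset.mem_product, Finset.mem_range, Finset.mem_Icc]
        omega
      exact not_lt.1 fun h => h2 (s, t) hmem ⟨hst, h⟩
  have hT' : (0 : ℝ) < M.T := by exact_mod_cast (by omega : 0 < M.T)
  have hlog := log_horizon_gt hT
  have hZ0 : P.real Z = 0 := by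
    rw [measureReal_eq_zero_iff]
    exact ae_iff.1 hM.ae_one_le_arrivals
  have hAle : P.real (⋃ p ∈ I, A p) ≤ δ :=
    calc P.real (⋃ p ∈ I, A p) ≤ ∑ p ∈ I, P.real (A p) := measureReal_biUnion_finset_le _ _
      _ ≤ ∑ _p ∈ I, δ / (M.T : ℝ) ^ 2 := by
          refine Finset.sum_le_sum fun p hp => ?_
          by_cases hle : p.1 ≤ p.2
          · refine (measureReal_mono fun ω hω => hω.2).trans
              (hM.measureReal_confN_lt_le hT hδ0 hδ1 hle ?_)
            exact (Finset.mem_Icc.1 (Finset.mem_product.1 hp).2).2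
          · simp only [hA, hle, false_and, Set.ofPred_false, measureReal_empty]
            positivity
      _ = δ := by
          simp [hI]
          field_simp
  have hCle : P.real (⋃ t ∈ Finset.Icc 1 M.T, C t) ≤ δ :=
    calc P.real (⋃ t ∈ Finset.Icc 1 M.T, C t) ≤ ∑ t ∈ Finset.Icc 1 M.T, P.real (C t) :=
          measureReal_biUnion_finset_le _ _
      _ ≤ ∑ t ∈ Finset.Icc 1 M.T, δ / (3 * Real.log M.T) * (t : ℝ)⁻¹ :=
          Finset.sum_le_sum fun t ht =>
            hM.measureReal_confP_lt_le hT hδ0 hδ1 (Finset.mem_Icc.1 ht).1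
      _ ≤ δ / (3 * Real.log M.T) * (3 * Real.log M.T) := by
          rw [← Finset.mul_sum]
          have := sum_inv_le_three_mul_log hT
          gcongr
      _ = δ := by field_simp
  calc P.real {ω | ¬ M.Good P δ ω}
      ≤ P.real (Z ∪ ((⋃ p ∈ I, A p) ∪ ⋃ t ∈ Finset.Icc 1 M.T, C t)) := measureReal_mono hsub
    _ ≤ P.real Z + (P.real (⋃ p ∈ I, A p) + P.real (⋃ t ∈ Finset.Icc 1 M.T, C t)) :=
        (measureReal_union_le _ _).trans (by gcongr; exact measureReal_union_le _ _)
    _ ≤ 2 * δ := by linarith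

end Probability

section Rates

variable {Θ Ω : Type*} {M : Model Θ Ω}

/-! ### The parameters of the model and the rates -/

lemma w_le_wMax [Finite Θ] (θ : Θ) : M.w θ ≤ M.wMax :=
  le_ciSup (Set.finite_range _).bddAbove θ

lemma Admissible.wMax_nonneg [MeasurableSpace Ω] {P : Measure Ω} (hM : M.Admissible P) : 0 ≤ M.wMax :=
  Real.iSup_nonneg fun θ => (hM.w_pos θ).le

variable [Fintype Θ] [MeasurableSpace Ω] {P : Measure Ω} {δ L : ℝ} {ω : Ω}

/-- The product of `1 + x` over the parameters `x` that `hiddenFactor` is made of. -/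
noncomputable def factorBase (M : Model Θ Ω) (P : Measure Ω) (δ : ℝ) : ℝ :=
  (1 + M.betaAvg P) * (1 + Fintype.card Θ) * (1 + M.wMax) * (1 + M.muMax P)
    * (1 + M.rhoMax P) * (1 + Real.log M.T) * (1 + Real.log (1 / δ))

lemma hiddenFactor_eq (K : ℝ) (k : ℕ) :
    M.hiddenFactor P δ K k = K * M.factorBase P δ ^ k := rfl

lemma betaAvg_nonneg (M : Model Θ Ω) (P : Measure Ω) : 0 ≤ M.betaAvg P :=
  div_nonneg (Nat.cast_nonneg _) (M.meanArrivals_nonneg P _ _)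

lemma muMax_nonneg (M : Model Θ Ω) (P : Measure Ω) : 0 ≤ M.muMax P :=
  Real.iSup_nonneg fun _ => integral_nonneg fun ω => M.arrivals_nonneg _ ω

lemma integral_arrivals_le_muMax {t : ℕ} (ht : t ∈ Finset.Icc 1 M.T) :
    ∫ ω, M.arrivals t ω ∂P ≤ M.muMax P :=
  le_ciSup (f := fun t : Finset.Icc 1 M.T => ∫ ω, M.arrivals t ω ∂P)
    (Set.finite_range _).bddAbove ⟨t, ht⟩

/-- All seven factors are at least 1, so each partial product is at most the whole. -/
lemma Admissible.factorBase_bounds (hM : M.Admissible P) (hT : 2 ≤ M.T) (hδ0 : 0 < δ)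
    (hδ1 : δ < 1) :
    1 + M.betaAvg P ≤ M.factorBase P δ ∧ 1 + M.wMax ≤ M.factorBase P δ ∧
      1 + M.muMax P ≤ M.factorBase P δ ∧
      (1 + Fintype.card Θ) * (1 + M.rhoMax P) * ((1 + Real.log M.T) * (1 + Real.log (1 / δ)))
        ≤ M.factorBase P δ := by
  have ha : 1 ≤ 1 + M.betaAvg P := by have := M.betaAvg_nonneg P; linarith
  have hb : 1 ≤ 1 + (Fintype.card Θ : ℝ) := by
    have : (0 : ℝ) ≤ Fintype.card Θ := Nat.cast_nonneg _
    linarith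
  have hc : 1 ≤ 1 + M.wMax := by have := hM.wMax_nonneg; linarith
  have hd : 1 ≤ 1 + M.muMax P := by have := M.muMax_nonneg P; linarith
  have he : 1 ≤ 1 + M.rhoMax P := by have := M.rhoMax_nonneg P; linarith
  have hf : 1 ≤ 1 + Real.log M.T := by have := log_horizon_gt hT; linarith
  have hg : 1 ≤ 1 + Real.log (1 / δ) := by
    have : 0 ≤ Real.log (1 / δ) := Real.log_nonneg (by rw [le_div_iff₀ hδ0]; linarith)
    linarith
  rw [factorBase]
  generalize 1 + M.betaAvg P = a at *
  generalize 1 + (Fintype.card Θ : ℝ) = b at *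
  generalize 1 + M.wMax = c at *
  generalize 1 + M.muMax P = d at *
  generalize 1 + M.rhoMax P = e at *
  generalize 1 + Real.log M.T = f at *
  generalize 1 + Real.log (1 / δ) = g at *
  have h1 : ∀ x y : ℝ, 1 ≤ x → 1 ≤ y → 1 ≤ x * y := fun x y hx hy =>
    one_le_mul_of_one_le_of_one_le hx hy
  have key : ∀ x y z : ℝ, 1 ≤ x → 1 ≤ y → z = x * y → x ≤ z := fun x y z hx hy hz =>
    hz ▸ le_mul_of_one_le_right (by linarith) hy
  refine ⟨key _ (b * c * d * e * f * g) _ ha ?_ (by ring),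
    key _ (a * b * d * e * f * g) _ hc ?_ (by ring),
    key _ (a * b * c * e * f * g) _ hd ?_ (by ring),
    key _ (a * c * d) _ ?_ ?_ (by ring)⟩ <;>
  · repeat' first | assumption | apply h1

lemma Admissible.one_le_factorBase (hM : M.Admissible P) (hT : 2 ≤ M.T) (hδ0 : 0 < δ)
    (hδ1 : δ < 1) : 1 ≤ M.factorBase P δ := by
  have := (hM.factorBase_bounds hT hδ0 hδ1).1
  have := M.betaAvg_nonneg P
  linarith

lemma Admissible.confN_le (hM : M.Admissible P) (hT : 2 ≤ M.T) (hδ0 : 0 < δ) (hδ1 : δ < 1)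
    {s t : ℕ} (hst : s ≤ t) :
    M.confN P δ s t ≤ 2 * M.factorBase P δ * Real.sqrt ((t : ℝ) - s) := by
  have hQ := (hM.factorBase_bounds hT hδ0 hδ1).2.2.2
  have hn : (0 : ℝ) ≤ (t : ℝ) - s := sub_nonneg.2 (by exact_mod_cast hst)
  have hT' : (0 : ℝ) < M.T := by exact_mod_cast (by omega : 0 < M.T)
  have hu := log_horizon_gt hT
  have hv : 0 ≤ Real.log (1 / δ) := Real.log_nonneg (by rw [le_div_iff₀ hδ0]; linarith)
  have hlog : Real.log (2 * (M.T : ℝ) ^ 2 / δ)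
      ≤ 2 * ((1 + Real.log M.T) * (1 + Real.log (1 / δ))) := by
    rw [div_eq_mul_one_div, Real.log_mul (by positivity) (by positivity),
      Real.log_mul (by norm_num) (by positivity), Real.log_pow]
    have := Real.log_two_lt_d9
    have := mul_nonneg (by linarith : 0 ≤ Real.log M.T) hv
    push_cast
    linarith
  have hρ := M.rhoMax_nonneg P
  have hb : (0 : ℝ) ≤ Fintype.card Θ := Nat.cast_nonneg _
  have huv : 1 ≤ (1 + Real.log M.T) * (1 + Real.log (1 / δ)) :=
    one_le_mul_of_one_le_of_one_le (by linarith) (by linarith)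
  rw [confN]
  refine Real.sqrt_le_iff.2 ⟨?_, ?_⟩
  · have : 0 ≤ M.factorBase P δ := le_trans (by positivity) hQ
    positivity
  · rw [mul_pow, Real.sq_sqrt hn]
    generalize (1 + Real.log M.T) * (1 + Real.log (1 / δ)) = y at *
    generalize M.rhoMax P = ρ at *
    generalize (Fintype.card Θ : ℝ) = b at *
    calc 2 * ((t : ℝ) - s) * b * ρ ^ 2 * Real.log (2 * (M.T : ℝ) ^ 2 / δ)
        ≤ 2 * ((t : ℝ) - s) * b * ρ ^ 2 * (2 * y) := by gcongr
      _ = 4 * ((t : ℝ) - s) * (b * ρ ^ 2 * y) := by ring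
      -- Crude bounds such as `y ≤ y ^ 2` for `y ≥ 1` complete the square of a partial product of
      -- `factorBase`.
      _ ≤ 4 * ((t : ℝ) - s) * ((1 + b) ^ 2 * (1 + ρ) ^ 2 * y ^ 2) := by
          gcongr
          · nlinarith
          · linarith
          · nlinarith
      _ = 4 * ((t : ℝ) - s) * ((1 + b) * (1 + ρ) * y) ^ 2 := by ring
      _ ≤ 4 * ((t : ℝ) - s) * M.factorBase P δ ^ 2 := by gcongr
      _ = (2 * M.factorBase P δ) ^ 2 * ((t : ℝ) - s) := by ring

lemma inefficiency_guardrail_eq : M.inefficiency (M.guardrail P δ L) ω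
    = M.B - ∑ r ∈ Finset.Ioc 0 M.T, M.amount P δ L r ω := by
  simp only [inefficiency, guardrail, amount, arrivals, Finset.sum_mul]
  rfl

variable [IsProbabilityMeasure P]

lemma Admissible.meanArrivals_le (hM : M.Admissible P) {s t : ℕ} (hst : s ≤ t) (ht : t ≤ M.T) :
    M.meanArrivals P s t ≤ ((t : ℝ) - s) * M.muMax P := by
  have hmem : ∀ r ∈ Finset.Ioc s t, r ∈ Finset.Icc 1 M.T := fun r hr => by
    simp only [Finset.mem_Ioc, Finset.mem_Icc] at hr ⊢
    omega
  simp only [meanArrivals, arrivalsIoc]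
  rw [integral_finsetSum _ fun r hr => hM.integrable_arrivals (hmem r hr)]
  refine (Finset.sum_le_sum fun r hr => integral_arrivals_le_muMax (hmem r hr)).trans_eq ?_
  simp [Nat.cast_sub hst]

lemma Admissible.le_meanArrivals [Nonempty Θ] (hM : M.Admissible P) :
    (M.T : ℝ) ≤ M.meanArrivals P 0 M.T := by
  have hint : Integrable (M.arrivalsIoc 0 M.T) P :=
    integrable_finsetSum _ fun r hr => hM.integrable_arrivals hr
  have h : ∀ᵐ ω ∂P, (M.T : ℝ) ≤ M.arrivalsIoc 0 M.T ω := by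
    filter_upwards [hM.ae_one_le_arrivals] with ω hω
    have := Finset.card_nsmul_le_sum (Finset.Ioc 0 M.T) (fun r => M.arrivals r ω) 1 hω
    simpa [arrivalsIoc] using this
  have := integral_mono_ae (integrable_const (M.T : ℝ)) hint h
  simpa [meanArrivals] using this

/-- The confidence bound for the one-round window: mean at most `Q`, deviation at most `2Q`, where
`Q` is `factorBase`. -/
lemma Good.arrivals_le (h : M.Good P δ ω) (hM : M.Admissible P) (hT : 2 ≤ M.T) (hδ0 : 0 < δ)
    (hδ1 : δ < 1) {t : ℕ} (ht : t ∈ Finset.Icc 1 M.T) :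
    M.arrivals t ω ≤ 3 * M.factorBase P δ := by
  obtain ⟨ht1, ht2⟩ := Finset.mem_Icc.1 ht
  obtain ⟨t, rfl⟩ := Nat.exists_eq_add_of_le' ht1
  have h1 := (abs_le.1 (h.abs_arrivals_sub_le t (t + 1) t.le_succ ht2)).2
  have h2 := hM.confN_le hT hδ0 hδ1 t.le_succ
  have h3 := hM.meanArrivals_le t.le_succ ht2
  have h4 := (hM.factorBase_bounds hT hδ0 hδ1).2.2.1
  rw [arrivalsIoc_succ le_rfl, arrivalsIoc_self] at h1
  simp at h1 h2 h3
  linarith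

lemma Admissible.upperN_le (hM : M.Admissible P) (hT : 2 ≤ M.T) (hδ0 : 0 < δ) (hδ1 : δ < 1) :
    M.upperN P δ 0 ≤ 3 * M.factorBase P δ * M.T := by
  have h2 := hM.confN_le hT hδ0 hδ1 (Nat.zero_le M.T)
  have h3 := hM.meanArrivals_le (Nat.zero_le M.T) le_rfl
  have h4 := (hM.factorBase_bounds hT hδ0 hδ1).2.2.1
  have hQ := hM.one_le_factorBase hT hδ0 hδ1
  have hT1 : (1 : ℝ) ≤ M.T := by exact_mod_cast (by omega : 1 ≤ M.T)
  have hs : Real.sqrt M.T ≤ M.T := Real.sqrt_le_self_iff.2 (Or.inr hT1)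
  rw [Nat.cast_zero, sub_zero] at h2 h3
  rw [upperN]
  nlinarith

lemma Admissible.div_upperN_le [Nonempty Θ] (hM : M.Admissible P) (hT : 2 ≤ M.T) (hδ0 : 0 < δ)
    (hδ1 : δ < 1) : M.B / M.upperN P δ 0 ≤ M.factorBase P δ := by
  have h1 := (hM.factorBase_bounds hT hδ0 hδ1).1
  have h2 : (0 : ℝ) < M.meanArrivals P 0 M.T :=
    lt_of_lt_of_le (by exact_mod_cast (by omega : 0 < M.T)) hM.le_meanArrivals
  have h3 : M.B / M.upperN P δ 0 ≤ M.betaAvg P := by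
    rw [betaAvg]
    gcongr
    exact le_add_of_nonneg_right (M.confN_nonneg δ P _ _)
  linarith

lemma perishLoss_nonneg (hT : 2 ≤ M.T) (hδ0 : 0 < δ) (hδ1 : δ < 1)
    (hN : 0 < M.upperN P δ 0) : 0 ≤ M.perishLoss P δ := by
  have h1 := upperN_mul_perishLoss (P := P) hT hδ0 hδ1 hN
  have h2 := worstLoss_nonneg (M := M) (P := P) hT hδ0 hδ1 (M.xLow P δ)
  exact nonneg_of_mul_nonneg_right (h1 ▸ h2) hN

/-! ### Envy and inefficiency on a good outcome -/

variable [Nonempty Θ]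

theorem Good.hindsightEnvy_le (h : M.Good P δ ω) (hM : M.Admissible P) (hT : 2 ≤ M.T)
    (hδ0 : 0 < δ) (hδ1 : δ < 1) (hL : 0 ≤ L) :
    M.hindsightEnvy (M.guardrail P δ L) ω ≤ M.factorBase P δ * L := by
  have : Nonempty (Finset.Icc 1 M.T) := ⟨⟨1, by simp; omega⟩⟩
  refine ciSup_le fun p => ?_
  have h1 := decision_le_xUp hL (h.served hL hT hδ0 hδ1 p.2.1.2)
  have h2 := xLow_le_decision hL (h.served hL hT hδ0 hδ1 p.1.1.2)
  have h3 := w_le_wMax (M := M) p.1.2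
  have h4 := (hM.factorBase_bounds hT hδ0 hδ1).2.1
  have h5 := hM.w_pos p.1.2
  simp only [guardrail]
  calc M.w p.1.2 * _ ≤ M.w p.1.2 * L := by
        gcongr
        simp only [xUp] at h1
        linarith
    _ ≤ _ := by
        gcongr
        linarith

/-- `B / N - xLow` splits into `perishLoss` and `B / N - B / upperN`. The latter is nonnegative and
at most `B / upperN` times `2 * confN / N`, where `N ≥ T`. -/
theorem Good.counterfactualEnvy_le (h : M.Good P δ ω) (hM : M.Admissible P) (hT : 2 ≤ M.T)
    (hδ0 : 0 < δ) (hδ1 : δ < 1) (hL : 0 ≤ L) :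
    M.counterfactualEnvy (M.guardrail P δ L) ω
      ≤ M.factorBase P δ * (L + M.perishLoss P δ + 4 * M.factorBase P δ ^ 2 / Real.sqrt M.T) := by
  have : Nonempty (Finset.Icc 1 M.T) := ⟨⟨1, by simp; omega⟩⟩
  refine ciSup_le fun p => ?_
  have h1 := decision_le_xUp hL (h.served hL hT hδ0 hδ1 p.1.2)
  have h2 := xLow_le_decision hL (h.served hL hT hδ0 hδ1 p.1.2)
  have h3 := w_le_wMax (M := M) p.2
  have h4 := (hM.factorBase_bounds hT hδ0 hδ1).2.1
  have h5 := hM.w_pos p.2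
  have hup := h.upperN_pos hT
  have hl := perishLoss_nonneg (P := P) hT hδ0 hδ1 hup
  have hx : M.xLow P δ = M.B / M.upperN P δ 0 - M.perishLoss P δ := by rw [perishLoss]; ring
  have hT0 : (0 : ℝ) < M.T := by exact_mod_cast (by omega : 0 < M.T)
  have hNT : (M.T : ℝ) ≤ M.totalArrivals ω := by
    simpa [totalArrivals] using h.sub_le_arrivalsIoc (Nat.zero_le M.T) le_rfl
  have hN : 0 < M.totalArrivals ω := hT0.trans_le hNT
  have hle : M.totalArrivals ω ≤ M.upperN P δ 0 := h.le_upperN (Nat.zero_le M.T)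
  have hge : M.upperN P δ 0 ≤ M.totalArrivals ω + 2 * M.confN P δ 0 M.T :=
    h.upperN_le (Nat.zero_le M.T)
  have hconf := hM.confN_le hT hδ0 hδ1 (Nat.zero_le M.T)
  rw [Nat.cast_zero, sub_zero] at hconf
  have hQ := hM.div_upperN_le hT hδ0 hδ1
  have hQ1 := hM.one_le_factorBase hT hδ0 hδ1
  have hsub : (M.B : ℝ) / M.totalArrivals ω - M.B / M.upperN P δ 0
      = M.B / M.upperN P δ 0 * ((M.upperN P δ 0 - M.totalArrivals ω) / M.totalArrivals ω) := by
    field_simp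
  have hsub0 : 0 ≤ (M.B : ℝ) / M.totalArrivals ω - M.B / M.upperN P δ 0 := by
    rw [hsub]
    have := sub_nonneg.2 hle
    positivity
  have hsub1 : (M.B : ℝ) / M.totalArrivals ω - M.B / M.upperN P δ 0
      ≤ 4 * M.factorBase P δ ^ 2 / Real.sqrt M.T := by
    rw [hsub]
    calc _ ≤ M.factorBase P δ * (4 * M.factorBase P δ * Real.sqrt M.T / M.T) := by
          have := sub_nonneg.2 hle
          gcongr
          linarith
      _ = _ := by
          have hsq := Real.mul_self_sqrt hT0.le
          have : 0 < Real.sqrt M.T := Real.sqrt_pos.2 hT0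
          conv_lhs => rw [← hsq]
          rw [Real.sqrt_mul_self this.le]
          field_simp
  simp only [guardrail]
  rw [abs_mul, abs_of_pos h5]
  calc M.w p.2 * |_| ≤ M.w p.2 * (L + M.perishLoss P δ
        + 4 * M.factorBase P δ ^ 2 / Real.sqrt M.T) := by
        gcongr
        simp only [xUp] at h1
        rw [abs_le]
        constructor <;> linarith
    _ ≤ _ := by
        gcongr
        linarith

/-- The bound on the inefficiency that only uses that the lower guardrail is always granted. -/
theorem Good.inefficiency_le_sqrt (h : M.Good P δ ω) (hM : M.Admissible P) (hT : 2 ≤ M.T)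
    (hδ0 : 0 < δ) (hδ1 : δ < 1) (hL : 0 ≤ L) :
    M.inefficiency (M.guardrail P δ L) ω
      ≤ 3 * M.factorBase P δ * (M.T * M.perishLoss P δ)
        + 4 * M.factorBase P δ ^ 2 * Real.sqrt M.T := by
  have hup := h.upperN_pos hT
  have hl := perishLoss_nonneg (P := P) hT hδ0 hδ1 hup
  have hfix := xLow_mul_upperN (P := P) hT hδ0 hδ1 hup
  have hloss := upperN_mul_perishLoss (P := P) hT hδ0 hδ1 hup
  have hamount := xLow_mul_arrivalsIoc_le_sum_amount (ω := ω) (t := M.T) hL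
    fun r hr => h.served hL hT hδ0 hδ1 hr
  have hge := h.upperN_le (Nat.zero_le M.T)
  have hconf := hM.confN_le hT hδ0 hδ1 (Nat.zero_le M.T)
  rw [Nat.cast_zero, sub_zero] at hconf
  have hx0 := M.xLow_nonneg P δ
  have hx : M.xLow P δ ≤ M.factorBase P δ := by
    have := hM.div_upperN_le hT hδ0 hδ1
    rw [perishLoss] at hl
    linarith
  have hworst : M.worstLoss P δ (M.xLow P δ)
      ≤ 3 * M.factorBase P δ * (M.T * M.perishLoss P δ) := by
    rw [← hloss, ← mul_assoc]
    exact mul_le_mul_of_nonneg_right (hM.upperN_le hT hδ0 hδ1) hl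
  have hgap : M.xLow P δ * (M.upperN P δ 0 - M.arrivalsIoc 0 M.T ω)
      ≤ M.factorBase P δ * (4 * M.factorBase P δ * Real.sqrt M.T) := by
    have := sub_nonneg.2 (h.le_upperN (Nat.zero_le M.T))
    exact mul_le_mul hx (by linarith) this (hx0.trans hx)
  rw [inefficiency_guardrail_eq]
  linarith

/-- The bound on the inefficiency that uses the upper guardrail. -/
theorem Good.inefficiency_le_inv (h : M.Good P δ ω) (hM : M.Admissible P) (hT : 2 ≤ M.T)
    (hδ0 : 0 < δ) (hδ1 : δ < 1) (hL : 0 < L) :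
    M.inefficiency (M.guardrail P δ L) ω
      ≤ 6 * M.factorBase P δ * (M.T * M.perishLoss P δ) + 3 * M.factorBase P δ * L
        + 4 * M.factorBase P δ ^ 4 * L⁻¹ := by
  have hup := h.upperN_pos hT
  have hl := perishLoss_nonneg (P := P) hT hδ0 hδ1 hup
  have hloss := upperN_mul_perishLoss (P := P) hT hδ0 hδ1 hup
  have hQ1 := hM.one_le_factorBase hT hδ0 hδ1
  have hx0 := M.xLow_nonneg P δ
  have hx : M.xLow P δ ≤ M.factorBase P δ := by
    have := hM.div_upperN_le hT hδ0 hδ1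
    rw [perishLoss] at hl
    linarith
  have hworst : M.worstLoss P δ (M.xLow P δ)
      ≤ 3 * M.factorBase P δ * (M.T * M.perishLoss P δ) := by
    rw [← hloss, ← mul_assoc]
    exact mul_le_mul_of_nonneg_right (hM.upperN_le hT hδ0 hδ1) hl
  obtain ⟨s, hsT, hle⟩ := h.exists_unallocated_le hL.le hT hδ0 hδ1 (by positivity)
    (fun t ht => h.arrivals_le hM hT hδ0 hδ1 ht) le_rfl
  have hge := h.upperN_le hsT
  have hconf := hM.confN_le hT hδ0 hδ1 hsT
  have hN := h.sub_le_arrivalsIoc hsT le_rfl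
  have hn : (0 : ℝ) ≤ (M.T : ℝ) - s := sub_nonneg.2 (by exact_mod_cast hsT)
  have hgap : M.xLow P δ * (M.upperN P δ s - M.arrivalsIoc s M.T ω)
      ≤ M.factorBase P δ * (4 * M.factorBase P δ * Real.sqrt ((M.T : ℝ) - s)) := by
    have := sub_nonneg.2 (h.le_upperN hsT)
    exact mul_le_mul hx (by linarith) this (hx0.trans hx)
  have hLN := mul_le_mul_of_nonneg_left hN hL.le
  have hsq := Real.sq_sqrt hn
  -- Maximizing `4Q²x - Lx²` over `x = √(T - s)`; the maximum is at `x = 2Q² / L`.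
  have hamgm : 4 * M.factorBase P δ ^ 2 * Real.sqrt ((M.T : ℝ) - s) - L * ((M.T : ℝ) - s)
      ≤ 4 * M.factorBase P δ ^ 4 * L⁻¹ := by
    rw [← hsq, Real.sqrt_sq (Real.sqrt_nonneg _), ← div_eq_mul_inv, le_div_iff₀ hL]
    nlinarith [sq_nonneg (L * Real.sqrt ((M.T : ℝ) - s) - 2 * M.factorBase P δ ^ 2)]
  rw [inefficiency_guardrail_eq]
  simp only [xUp] at hle
  linarith

end Rates

end Model

end PerishingGuardrail

theorem mainTheorem1 :
    ∃ (K : ℝ) (k : ℕ), 0 < K ∧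
      ∀ (Θ Ω : Type*) [Fintype Θ] [Nonempty Θ] [MeasurableSpace Ω]
        (P : Measure Ω) [IsProbabilityMeasure P]
        (M : PerishingGuardrail.Model Θ Ω), M.Admissible P → 2 ≤ M.T →
      ∀ δ L : ℝ, 0 < δ → δ < 1 → 0 ≤ L →
        1 - 2 * δ ≤ P.real {ω |
          M.counterfactualEnvy (M.guardrail P δ L) ω ≤
              M.hiddenFactor P δ K k * max L (M.perishLoss P δ + 1 / Real.sqrt M.T) ∧
          M.inefficiency (M.guardrail P δ L) ω ≤
              M.hiddenFactor P δ K k * (1 + L) ^ k *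
                (PerishingGuardrail.efficiencyRate M.T L (M.perishLoss P δ)
                  + M.T * M.perishLoss P δ) ∧
          M.hindsightEnvy (M.guardrail P δ L) ω ≤ M.hiddenFactor P δ K k * L} := by
  -- The power 4 comes from the `Q ^ 4 * L⁻¹` of `inefficiency_le_inv`; 8 dominates all the
  -- constants, the largest sum being 3 + 4.
  refine ⟨8, 4, by norm_num, ?_⟩
  intro Θ Ω _ _ _ P _ M hM hT δ L hδ0 hδ1 hL
  have hbad := hM.measureReal_not_good_le hT hδ0 hδ1
  -- Subadditivity suffices, so measurability of the good event is not required.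
  have huniv : 1 ≤ P.real {ω | M.Good P δ ω} + P.real {ω | ¬ M.Good P δ ω} := by
    refine le_trans (le_of_eq ?_) (measureReal_union_le _ _)
    rw [← probReal_univ (μ := P)]
    congr 1
    ext ω
    simpa using Classical.em _
  refine (show 1 - 2 * δ ≤ P.real {ω | M.Good P δ ω} by linarith).trans
    (measureReal_mono fun ω (h : M.Good P δ ω) => ?_)
  have hl := PerishingGuardrail.Model.perishLoss_nonneg (P := P) hT hδ0 hδ1 (h.upperN_pos hT)
  have hQ := hM.one_le_factorBase hT hδ0 hδ1
  have hT0 : (0 : ℝ) < M.T := by exact_mod_cast (by omega : 0 < M.T)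
  have hs : 0 < Real.sqrt M.T := Real.sqrt_pos.2 hT0
  have h1 := h.counterfactualEnvy_le hM hT hδ0 hδ1 hL
  have h2 := h.inefficiency_le_sqrt hM hT hδ0 hδ1 hL
  have h3 := h.inefficiency_le_inv (L := L) hM hT hδ0 hδ1
  have h4 := h.hindsightEnvy_le hM hT hδ0 hδ1 hL
  simp only [PerishingGuardrail.Model.hiddenFactor_eq]
  generalize M.factorBase P δ = Q at *
  generalize M.perishLoss P δ = l at *
  have hpow : ∀ n ≤ 4, Q ^ n ≤ Q ^ 4 := fun n hn => pow_le_pow_right₀ hQ hn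
  have hQ4 : Q ≤ Q ^ 4 := by simpa using hpow 1 (by norm_num)
  have hTl : 0 ≤ M.T * l := by positivity
  have hW : 1 ≤ (1 + L) ^ 4 := one_le_pow₀ (by linarith)
  have hsqrt : 3 * Q * (M.T * l) + 4 * Q ^ 2 * Real.sqrt M.T
      ≤ 8 * Q ^ 4 * (1 + L) ^ 4 * (Real.sqrt M.T + M.T * l) := by
    have e1 : 3 * Q * (M.T * l) ≤ 8 * Q ^ 4 * (M.T * l) := by gcongr; linarith
    have e2 : 4 * Q ^ 2 * Real.sqrt M.T ≤ 8 * Q ^ 4 * Real.sqrt M.T := by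
      have := hpow 2 (by norm_num)
      gcongr
      linarith
    calc _ ≤ 8 * Q ^ 4 * 1 * (Real.sqrt M.T + M.T * l) := by linarith
      _ ≤ _ := by gcongr
  refine ⟨h1.trans ?_, ?_, h4.trans ?_⟩
  · have e1 := le_max_left L (l + 1 / Real.sqrt M.T)
    have e2 := le_max_right L (l + 1 / Real.sqrt M.T)
    set m := max L (l + 1 / Real.sqrt M.T)
    have e3 : 1 ≤ Q ^ 2 := one_le_pow₀ hQ
    have e4 : l + 4 * Q ^ 2 / Real.sqrt M.T ≤ 4 * Q ^ 2 * m :=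
      calc l + 4 * Q ^ 2 / Real.sqrt M.T ≤ 4 * Q ^ 2 * l + 4 * Q ^ 2 / Real.sqrt M.T := by
            nlinarith
        _ = 4 * Q ^ 2 * (l + 1 / Real.sqrt M.T) := by ring
        _ ≤ _ := by gcongr
    have hm : 0 ≤ m := hL.trans e1
    have e5 := hpow 3 (by norm_num)
    calc Q * (L + l + 4 * Q ^ 2 / Real.sqrt M.T) ≤ Q * (m + 4 * Q ^ 2 * m) :=
          mul_le_mul_of_nonneg_left (by linarith) (by linarith)
      _ = (Q + 4 * Q ^ 3) * m := by ring
      _ ≤ 8 * Q ^ 4 * m := by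
          gcongr
          linarith
  · rw [PerishingGuardrail.efficiencyRate]
    split_ifs with hL0
    · exact h2.trans hsqrt
    · have hLpos : 0 < L := lt_of_le_of_ne hL (Ne.symm hL0)
      rcases min_choice (Real.sqrt M.T) (L⁻¹ + Real.sqrt (M.T * L⁻¹ * l)) with hmin | hmin
      · rw [hmin]
        exact h2.trans hsqrt
      · rw [hmin]
        refine (h3 hLpos).trans ?_
        have hinv : 0 < L⁻¹ := inv_pos.2 hLpos
        -- The additive term `3QL` is absorbed as `L = L² L⁻¹`, at the price of the factor `(1 + L)
        -- ^ 4`.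
        have hLW : L ^ 2 ≤ (1 + L) ^ 4 := by nlinarith [sq_nonneg L, pow_pos hLpos 3, pow_pos hLpos 4]
        have e1 : 3 * Q * L ≤ 3 * Q ^ 4 * ((1 + L) ^ 4 * L⁻¹) := by
          have : L = L ^ 2 * L⁻¹ := by field_simp
          calc 3 * Q * L = 3 * Q * (L ^ 2 * L⁻¹) := by rw [← this]
            _ ≤ _ := by gcongr
        have e2 : 4 * Q ^ 4 * L⁻¹ ≤ 4 * Q ^ 4 * ((1 + L) ^ 4 * L⁻¹) := by
          gcongr
          exact le_mul_of_one_le_left hinv.le hW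
        have e3 : 6 * Q * (M.T * l) ≤ 6 * Q ^ 4 * ((1 + L) ^ 4 * (M.T * l)) := by
          have := le_mul_of_one_le_left hTl hW
          gcongr ?_ * ?_
          linarith
        have e4 : 0 ≤ Q ^ 4 * ((1 + L) ^ 4 * L⁻¹) := by positivity
        have e5 : 0 ≤ Q ^ 4 * ((1 + L) ^ 4 * (M.T * l)) := by positivity
        -- The bound proved has no mixed square-root term; the one in the claimed rate is just
        -- nonnegative slack.
        have e6 : 0 ≤ Q ^ 4 * ((1 + L) ^ 4 * Real.sqrt (M.T * L⁻¹ * l)) := by positivity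
        linarith
  · gcongr
    linarith
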